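/- **Definitions.** *Frames.* An element $k$ of a complete lattice $L$ is compact if $k\le\bigvee S$ implies $k\le\bigvee T$ for some finite $T\subseteq S$. A *generalized Stone frame* is a frame $L$ that is algebraic (every element is a join of compact elements) and zero-dimensional (every element is a join of complemented elements). Let $\mathsf{GStoneFrm_J}$ be the category of generalized Stone frames and maps preserving arbitrary joins and compact elements. $\mathsf{GStoneFrm_S}$ is the wide subcategory of those $\alpha$ with $\alpha(\bigwedge S)=\bigwedge\alpha[S]$ whenever $S$ is a nonempty finite set of compact elements with $\bigwedge S$ compact. $\mathsf{GStoneFrm}$ is the wide subcategory of those $\alpha$ that preserve all finite meets (frame homomorphisms preserving compact elements). *Generalized Boolean algebras.* A meet-semilattice $M$ with top $1$ is distributive if $a\wedge b\le c$ implies $c=a'\wedge b'$ for some $a'\ge a$, $b'\ge b$. A *generalized Boolean algebra* is a distributive meet-semilattice with top that is a lattice and in which every interval $[a,1]$ is a Boolean algebra (it need not have a bottom). Let $\mathsf{GBA_M}$ be the category of generalized Boolean algebras and maps preserving finite meets (including $1$). $\mathsf{GBA}$ is the wide subcategory of those maps that preserve joins of nonempty finite sets (lattice homomorphisms preserving $1$).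 $\mathsf{GBA_P}$ is the wide subcategory of $\mathsf{GBA_M}$ of those $\alpha:M_1\to M_2$ such that for every finite (possibly empty) $S\subseteq M_1$ and every upper bound $x$ of $\alpha[S]$ there is an upper bound $c$ of $S$ with $\alpha(c)\le x$. *Spaces.* A Priestley space is a compact space with a partial order such that $x\not\le y$ implies that some clopen upset contains $x$ and misses $y$. A *pointed generalized Priestley space* is a Priestley space $X$ with a point $m$ and a subset $X_0\subseteq X\setminus\{m\}$ such that, calling a clopen upset $U$ *admissible* if $\max(X\setminus U)\subseteq X_0$, writing $\mathcal A(X)$ for the set of admissible clopen upsets and $\mathcal I_x=\{U\in\mathcal A(X): x\notin U\}$: $m$ is the greatest element of $X$; $X_0$ is dense in $X\setminus\{m\}$; every $x\ne m$ is below some $y\in X_0$; $x\in X_0$ iff $\mathcal I_x$ is nonempty and directed under inclusion; and $x\le y$ iff every $U\in\mathcal A(X)$ containing $x$ contains $y$. It is a *pointed Stone space* if $X_0=X\setminus\{m\}$ and the restriction of $\le$ to $X_0$ is the identity. For $R\subseteq X\times Y$ put $\Box_RU=\{x: R[x]\subseteq U\}$. A *generalized Priestley morphism* $R\subseteq X\times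 Y$ is a relation such that if not $xRy$, then some $U\in\mathcal A(Y)$ has $R[x]\subseteq U$ and $y\notin U$, and such that $U\in\mathcal A(Y)$ implies $\Box_RU\in\mathcal A(X)$. Identities are $\le$, and the composition $S*R$ of $R\subseteq X\times Y$ and $S\subseteq Y\times Z$ is given by $x(S*R)z$ iff for all $U\in\mathcal A(Z)$, $x\in\Box_R\Box_SU$ implies $z\in U$. A *strong Priestley morphism* is an order-preserving map $f:X\to Y$ with $f^{-1}(U)\in\mathcal A(X)$ for all $U\in\mathcal A(Y)$. Let $\mathsf{PStone}$ be the category of pointed Stone spaces and generalized Priestley morphisms, $\mathsf{PStone_S}$ the category of pointed Stone spaces and strong Priestley morphisms (with usual composition), and $\mathsf{PStone_P}$ the wide subcategory of $\mathsf{PStone_S}$ of those $f$ with $f[X_0]\subseteq Y_0$. **Theorem.** 1. $\mathsf{GStoneFrm_J}$ is equivalent to $\mathsf{GBA_M}$ and dually equivalent to $\mathsf{PStone}$. 2. $\mathsf{GStoneFrm_S}$ is equivalent to $\mathsf{GBA}$ and dually equivalent to $\mathsf{PStone_S}$. 3. $\mathsf{GStoneFrm}$ is equivalent to $\mathsf{GBA_P}$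 and dually equivalent to $\mathsf{PStone_P}$. -/

import Mathlib

open CategoryTheory

universe u

namespace PointedStone

/-! ### Distributive meet-semilattices and generalized Boolean algebras

`SemilatInfCat` is Mathlib's category of meet-semilattices with top and maps that preserve all
finite meets (including the top). -/

/-- A meet-semilattice is distributive if `a ⊓ b ≤ c` implies `c = a' ⊓ b'` for some
`a' ≥ a` and `b' ≥ b`. -/
def IsDistributive : ObjectProperty SemilatInfCat.{u} := fun M =>
  ∀ a b c : M, a ⊓ b ≤ c → ∃ a' b' : M, a ≤ a' ∧ b ≤ b' ∧ a' ⊓ b' = c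

/-- Distributive meet-semilattices (with top), with all meet-semilattice homomorphisms. -/
abbrev DMS : Type (u + 1) := IsDistributive.{u}.FullSubcategory

/-- The map underlying a morphism of distributive meet-semilattices. -/
def DMS.toFun {M N : DMS.{u}} (α : M ⟶ N) : M.obj → N.obj := fun x =>
  (show InfTopHom M.obj N.obj from α.hom) x

theorem DMS.toFun_mono {M N : DMS.{u}} (α : M ⟶ N) : Monotone (DMS.toFun α) := fun _ _ h =>
  OrderHomClass.mono (show InfTopHom M.obj N.obj from α.hom) h

/-- The morphism preserves all existing joins of nonempty finite sets. -/
def IsSupMorphism : MorphismProperty DMS.{u} := fun M _ α =>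
  ∀ S : Set M.obj, S.Finite → S.Nonempty → ∀ a : M.obj, IsLUB S a →
    IsLUB (DMS.toFun α '' S) (DMS.toFun α a)

/-- For every finite set `S` (possibly empty) and every upper bound `x` of `α[S]` there is an
upper bound `c` of `S` with `α c ≤ x`. -/
def IsPMorphism : MorphismProperty DMS.{u} := fun M N α =>
  ∀ S : Set M.obj, S.Finite → ∀ x : N.obj, x ∈ upperBounds (DMS.toFun α '' S) →
    ∃ c : M.obj, c ∈ upperBounds S ∧ DMS.toFun α c ≤ x

instance : IsSupMorphism.{u}.IsMultiplicative where
  id_mem M := by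
    intro S _ _ a ha
    have h : DMS.toFun (𝟙 M) = id := rfl
    rw [h, Set.image_id]
    exact ha
  comp_mem {M N K} α β hα hβ := by
    intro S hS hne a ha
    have h : DMS.toFun (α ≫ β) = DMS.toFun β ∘ DMS.toFun α := rfl
    rw [h, Set.image_comp]
    exact hβ _ (hS.image _) (hne.image _) _ (hα S hS hne a ha)

instance : IsPMorphism.{u}.IsMultiplicative where
  id_mem M := by
    intro S _ x hx
    have h : DMS.toFun (𝟙 M) = id := rfl
    rw [h, Set.image_id] at hx
    exact ⟨x, hx, le_rfl⟩
  comp_mem {M N K} α β hα hβ := by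
    intro S hS x hx
    have h : DMS.toFun (α ≫ β) = DMS.toFun β ∘ DMS.toFun α := rfl
    rw [h, Set.image_comp] at hx
    obtain ⟨c, hc, hcx⟩ := hβ _ (hS.image _) x hx
    obtain ⟨d, hd, hdc⟩ := hα S hS c hc
    exact ⟨d, hd, (DMS.toFun_mono β hdc).trans hcx⟩

/-- Distributive meet-semilattices with the morphisms that preserve existing nonempty finite
joins. -/
abbrev DMSS : Type (u + 1) := WideSubcategory IsSupMorphism.{u}

/-- Distributive meet-semilattices with the morphisms satisfying `IsPMorphism`. -/
abbrev DMSP : Type (u + 1) := WideSubcategory IsPMorphism.{u}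

/-- A distributive meet-semilattice `M` is a generalized Boolean algebra if it is a lattice and
every interval `[a, ⊤]` is complemented (hence, by distributivity, a Boolean algebra). -/
def IsGenBoolean (M : DMS.{u}) : Prop :=
  (∀ a b : M.obj, ∃ c : M.obj, IsLUB {a, b} c) ∧
    ∀ a x : M.obj, a ≤ x → ∃ y : M.obj, a ≤ y ∧ x ⊓ y = a ∧ IsLUB {x, y} ⊤

/-- Generalized Boolean algebras with maps preserving finite meets. -/
abbrev GBAM : Type (u + 1) :=
  ObjectProperty.FullSubcategory (fun M : DMS.{u} => IsGenBoolean M)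

/-- Generalized Boolean algebras with lattice homomorphisms preserving the top. -/
abbrev GBA : Type (u + 1) :=
  ObjectProperty.FullSubcategory (fun M : DMSS.{u} => IsGenBoolean M.obj)

/-- Generalized Boolean algebras with the morphisms satisfying `IsPMorphism`. -/
abbrev GBAP : Type (u + 1) :=
  ObjectProperty.FullSubcategory (fun M : DMSP.{u} => IsGenBoolean M.obj)

/-! ### Algebraic frames and generalized Stone frames -/

/-- Algebraic frames: the objects of the category whose morphisms preserve arbitrary joins and
compact elements. -/
structure AlgFrmJ : Type (u + 1) where
  carrier : Type u
  [frame : Order.Frame carrier]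
  [algebraic : IsCompactlyGenerated carrier]

attribute [instance] AlgFrmJ.frame AlgFrmJ.algebraic

/-- Maps preserving arbitrary joins and compact elements. -/
@[ext]
structure AlgFrmJ.Hom (L M : AlgFrmJ.{u}) : Type u where
  toHom : sSupHom L.carrier M.carrier
  map_compact : ∀ k : L.carrier, IsCompactElement k → IsCompactElement (toHom k)

instance : Category.{u} AlgFrmJ.{u} where
  Hom L M := AlgFrmJ.Hom L M
  id L := ⟨sSupHom.id L.carrier, fun _ hk => hk⟩
  comp f g := ⟨g.toHom.comp f.toHom, fun k hk => g.map_compact _ (f.map_compact k hk)⟩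

/-- If `S` is a nonempty finite set of compact elements whose meet is compact, then the morphism
preserves the meet of `S`. -/
def PreservesCompactMeets : MorphismProperty AlgFrmJ.{u} := fun L _ α =>
  ∀ S : Set L.carrier, S.Finite → S.Nonempty → (∀ k ∈ S, IsCompactElement k) →
    IsCompactElement (sInf S) → α.toHom (sInf S) = sInf (α.toHom '' S)

/-- The morphism preserves all finite meets, that is, it is a frame homomorphism. -/
def PreservesFiniteMeets : MorphismProperty AlgFrmJ.{u} := fun L _ α =>
  α.toHom ⊤ = ⊤ ∧ ∀ a b : L.carrier, α.toHom (a ⊓ b) = α.toHom a ⊓ α.toHom b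

instance : PreservesCompactMeets.{u}.IsMultiplicative where
  id_mem L := by
    intro S _ _ _ _
    change sInf S = sInf (id '' S)
    rw [Set.image_id]
  comp_mem {L M N} α β hα hβ := by
    intro S hS hne hk hm
    change β.toHom (α.toHom (sInf S)) = sInf ((β.toHom ∘ α.toHom) '' S)
    have h := hα S hS hne hk hm
    rw [Set.image_comp, h]
    refine hβ _ (hS.image _) (hne.image _) ?_ ?_
    · rintro _ ⟨k, hkS, rfl⟩
      exact α.map_compact k (hk k hkS)
    · rw [← h]
      exact α.map_compact _ hm

instance : PreservesFiniteMeets.{u}.IsMultiplicative where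
  id_mem L := ⟨rfl, fun _ _ => rfl⟩
  comp_mem {L M N} α β hα hβ := by
    refine ⟨?_, fun a b => ?_⟩
    · change β.toHom (α.toHom ⊤) = ⊤
      rw [hα.1, hβ.1]
    · change β.toHom (α.toHom (a ⊓ b)) = β.toHom (α.toHom a) ⊓ β.toHom (α.toHom b)
      rw [hα.2, hβ.2]

/-- Algebraic frames with the morphisms satisfying `PreservesCompactMeets`. -/
abbrev AlgFrmS : Type (u + 1) := WideSubcategory PreservesCompactMeets.{u}

/-- Algebraic frames with frame homomorphisms preserving compact elements. -/
abbrev AlgFrm : Type (u + 1) := WideSubcategory PreservesFiniteMeets.{u}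

/-- The complemented elements are join-dense. -/
def IsZeroDimensional (L : AlgFrmJ.{u}) : Prop :=
  ∀ a : L.carrier, ∃ S : Set L.carrier, (∀ x ∈ S, IsComplemented x) ∧ sSup S = a

/-- Generalized Stone frames, that is, algebraic zero-dimensional frames, with maps preserving
arbitrary joins and compact elements. -/
abbrev GStoneFrmJ : Type (u + 1) :=
  ObjectProperty.FullSubcategory (fun L : AlgFrmJ.{u} => IsZeroDimensional L)

/-- Generalized Stone frames with the morphisms satisfying `PreservesCompactMeets`. -/
abbrev GStoneFrmS : Type (u + 1) :=
  ObjectProperty.FullSubcategory (fun L : AlgFrmS.{u} => IsZeroDimensional L.obj)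

/-- Generalized Stone frames with frame homomorphisms preserving compact elements. -/
abbrev GStoneFrm : Type (u + 1) :=
  ObjectProperty.FullSubcategory (fun L : AlgFrm.{u} => IsZeroDimensional L.obj)

/-! ### Pointed generalized Priestley spaces and pointed Stone spaces -/

/-- A clopen upset `U` is admissible, relative to `X₀`, if all maximal elements of its complement
lie in `X₀`. -/
def Admissible {X : Type u} [TopologicalSpace X] [PartialOrder X] (X₀ : Set X) (U : Set X) :
    Prop :=
  IsClopen U ∧ IsUpperSet U ∧ ∀ x : X, Maximal (fun y => y ∉ U) x → x ∈ X₀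

/-- The admissible clopen upsets that miss `x`. -/
def admissibleMissing {X : Type u} [TopologicalSpace X] [PartialOrder X] (X₀ : Set X) (x : X) :
    Set (Set X) :=
  {U | Admissible X₀ U ∧ x ∉ U}

/-- Pointed generalized Priestley spaces. -/
structure PGPSpace : Type (u + 1) where
  carrier : Type u
  [topology : TopologicalSpace carrier]
  [order : PartialOrder carrier]
  [compact : CompactSpace carrier]
  [priestley : PriestleySpace carrier]
  /-- the distinguished subset -/
  X₀ : Set carrier
  /-- the distinguished point -/
  m : carrier
  le_m : ∀ x : carrier, x ≤ m
  m_notMem : m ∉ X₀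
  dense : ∀ x : carrier, x ≠ m → x ∈ closure X₀
  order_dense : ∀ x : carrier, x ≠ m → ∃ y ∈ X₀, x ≤ y
  mem_X₀_iff : ∀ x : carrier, x ∈ X₀ ↔
    (admissibleMissing X₀ x).Nonempty ∧ DirectedOn (· ⊆ ·) (admissibleMissing X₀ x)
  le_iff : ∀ x y : carrier, x ≤ y ↔ ∀ U : Set carrier, Admissible X₀ U → x ∈ U → y ∈ U

attribute [instance] PGPSpace.topology PGPSpace.order PGPSpace.compact PGPSpace.priestley

/-- `𝒜(X)`: the admissible clopen upsets of `X`. -/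
def PGPSpace.adm (X : PGPSpace.{u}) : Set (Set X.carrier) := {U | Admissible X.X₀ U}

/-- `□_R U = {x | R[x] ⊆ U}`. -/
def box {X Y : Type u} (R : X → Y → Prop) (U : Set Y) : Set X := {x | ∀ y, R x y → y ∈ U}

/-- Generalized Priestley morphisms. -/
@[ext]
structure GPMor (X Y : PGPSpace.{u}) : Type u where
  rel : X.carrier → Y.carrier → Prop
  separated : ∀ x y, ¬ rel x y → ∃ U ∈ Y.adm, (∀ z, rel x z → z ∈ U) ∧ y ∉ U
  box_mem : ∀ U ∈ Y.adm, box rel U ∈ X.adm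

/-- The composition `S * R` of relations, relative to the admissible clopen upsets of `Z`. -/
def starRel {X Y Z : PGPSpace.{u}} (S : Y.carrier → Z.carrier → Prop)
    (R : X.carrier → Y.carrier → Prop) (x : X.carrier) (z : Z.carrier) : Prop :=
  ∀ U ∈ Z.adm, x ∈ box R (box S U) → z ∈ U

theorem box_starRel {X Y Z : PGPSpace.{u}} (S : Y.carrier → Z.carrier → Prop)
    (R : X.carrier → Y.carrier → Prop) {U : Set Z.carrier} (hU : U ∈ Z.adm) :
    box (starRel S R) U = box R (box S U) := by
  ext x
  constructor
  · intro h y hxy z hyz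
    exact h z fun V _ hV => hV y hxy z hyz
  · intro h z hz
    exact hz U hU h

theorem box_le {X : PGPSpace.{u}} {U : Set X.carrier} (hU : IsUpperSet U) :
    box (fun x y : X.carrier => x ≤ y) U = U := by
  ext x
  exact ⟨fun h => h x le_rfl, fun h _ hxy => hU hxy h⟩

/-- The identity morphism is the order relation. -/
def GPMor.id (X : PGPSpace.{u}) : GPMor X X where
  rel x y := x ≤ y
  separated x y h := by
    rw [X.le_iff] at h
    push Not at h
    obtain ⟨U, hU, hx, hy⟩ := h
    exact ⟨U, hU, fun z hz => hU.2.1 hz hx, hy⟩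
  box_mem U hU := by
    rw [box_le hU.2.1]
    exact hU

/-- The composition `S * R` of generalized Priestley morphisms. -/
def GPMor.comp {X Y Z : PGPSpace.{u}} (S : GPMor Y Z) (R : GPMor X Y) : GPMor X Z where
  rel := starRel S.rel R.rel
  separated x z h := by
    unfold starRel at h
    push Not at h
    obtain ⟨U, hU, hx, hz⟩ := h
    exact ⟨U, hU, fun w hw => hw U hU hx, hz⟩
  box_mem U hU := by
    rw [box_starRel S.rel R.rel hU]
    exact R.box_mem _ (S.box_mem U hU)

/-- A generalized Priestley morphism is determined by `□` on admissible clopen upsets. -/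
theorem GPMor.ext_box {X Y : PGPSpace.{u}} {R S : GPMor X Y}
    (h : ∀ U ∈ Y.adm, box R.rel U = box S.rel U) : R = S := by
  have key : ∀ (R S : GPMor X Y), (∀ U ∈ Y.adm, box R.rel U = box S.rel U) →
      ∀ x y, R.rel x y → S.rel x y := by
    intro R S h x y hR
    by_contra hS
    obtain ⟨U, hU, hx, hy⟩ := S.separated x y hS
    have hx' : x ∈ box R.rel U := by
      rw [h U hU]
      exact hx
    exact hy (hx' y hR)
  apply GPMor.ext
  funext x y
  exact propext ⟨key R S h x y, key S R (fun U hU => (h U hU).symm) x y⟩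

theorem GPMor.box_comp {X Y Z : PGPSpace.{u}} (S : GPMor Y Z) (R : GPMor X Y)
    {U : Set Z.carrier} (hU : U ∈ Z.adm) :
    box (GPMor.comp S R).rel U = box R.rel (box S.rel U) :=
  box_starRel S.rel R.rel hU

theorem GPMor.box_id {X : PGPSpace.{u}} {U : Set X.carrier} (hU : U ∈ X.adm) :
    box (GPMor.id X).rel U = U :=
  box_le hU.2.1

/-- Pointed generalized Priestley spaces with generalized Priestley morphisms. -/
structure PGPS : Type (u + 1) where
  space : PGPSpace.{u}

instance : Category.{u} PGPS.{u} where
  Hom X Y := GPMor X.space Y.space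
  id X := GPMor.id X.space
  comp R S := GPMor.comp S R
  id_comp R := GPMor.ext_box fun U hU => by
    rw [GPMor.box_comp _ _ hU, GPMor.box_id (R.box_mem U hU)]
  comp_id R := GPMor.ext_box fun U hU => by
    rw [GPMor.box_comp _ _ hU, GPMor.box_id hU]
  assoc R S T := GPMor.ext_box fun U hU => by
    rw [GPMor.box_comp _ _ hU, GPMor.box_comp _ _ (T.box_mem U hU), GPMor.box_comp _ _ hU,
      GPMor.box_comp _ _ hU]

/-- Strong Priestley morphisms: order-preserving maps such that preimages of admissible clopen
upsets are admissible clopen upsets. -/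
@[ext]
structure StrongMor (X Y : PGPSpace.{u}) : Type u where
  toHom : X.carrier →o Y.carrier
  preimage_mem : ∀ U ∈ Y.adm, toHom ⁻¹' U ∈ X.adm

/-- Pointed generalized Priestley spaces with strong Priestley morphisms. -/
structure PGPSS : Type (u + 1) where
  space : PGPSpace.{u}

instance : Category.{u} PGPSS.{u} where
  Hom X Y := StrongMor X.space Y.space
  id X := ⟨OrderHom.id, fun _ hU => hU⟩
  comp f g := ⟨g.toHom.comp f.toHom, fun U hU => f.preimage_mem _ (g.preimage_mem U hU)⟩

/-- The strong Priestley morphism `f` satisfies `f[X₀] ⊆ Y₀`. -/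
def MapsX₀ : MorphismProperty PGPSS.{u} := fun X Y f =>
  ∀ x ∈ X.space.X₀, f.toHom x ∈ Y.space.X₀

instance : MapsX₀.{u}.IsMultiplicative where
  id_mem _ := fun _ hx => hx
  comp_mem f _ hf hg := fun x hx => hg (f.toHom x) (hf x hx)

/-- Pointed generalized Priestley spaces with strong Priestley morphisms that map the
distinguished subset into the distinguished subset. -/
abbrev PGPSP : Type (u + 1) := WideSubcategory MapsX₀.{u}

/-- A pointed generalized Priestley space is a pointed Priestley space if `X₀ = X ∖ {m}`. -/
def IsPointedPriestley (X : PGPSpace.{u}) : Prop := X.X₀ = {X.m}ᶜ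

/-- A pointed Priestley space is a pointed Stone space if `≤` restricts to the identity on
`X₀ = X ∖ {m}` (every point is below `m`). -/
def IsPointedStone (X : PGPSpace.{u}) : Prop :=
  IsPointedPriestley X ∧ ∀ x ∈ X.X₀, ∀ y ∈ X.X₀, x ≤ y → x = y

/-- Pointed Stone spaces with generalized Priestley morphisms. -/
abbrev PStone : Type (u + 1) :=
  ObjectProperty.FullSubcategory (fun X : PGPS.{u} => IsPointedStone X.space)

/-- Pointed Stone spaces with strong Priestley morphisms. -/
abbrev PStoneS : Type (u + 1) :=
  ObjectProperty.FullSubcategory (fun X : PGPSS.{u} => IsPointedStone X.space)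

/-- Pointed Stone spaces with strong Priestley morphisms satisfying `f[X₀] ⊆ Y₀`. -/
abbrev PStoneP : Type (u + 1) :=
  ObjectProperty.FullSubcategory (fun X : PGPSP.{u} => IsPointedStone X.obj.space)

end PointedStone

open PointedStone

namespace PointedStone

open CompleteLattice OrderDual

/-! ### Compact elements of generalized Stone frames -/

section Compact

variable {L N : Type u}

/-! Generalized Boolean algebras sit in the middle: frames and pointed Stone spaces are each
compared with them, and the dualities between frames and spaces are obtained by composition.

On the frame side, a compact element is a finite join of complemented elements, hence complemented,
so nonempty finite meets of compact elements are compact. The compact elements with reversed order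
therefore form a generalized Boolean algebra. By algebraicity, a map that preserves joins and
compact elements is the same as a homomorphism of the join-semilattices of compact elements, so
`compactFunctor` is fully faithful. `preservesCompactMeets_iff` and `preservesFiniteMeets_iff` match
the two stronger notions of morphism.

On the space side, the admissible clopen upsets of a pointed Stone space are exactly the clopen sets
that contain `m` (`IsPointedStone.mem_adm_iff`), and they form a generalized Boolean algebra.
Compactness realizes each meet-homomorphism as `□_R`, and each one that preserves binary joins as a
preimage map; the condition `f[X₀] ⊆ Y₀` is the case `S = ∅` of `IsPMorphism`.

Essential surjectivity of all functors rests on the spectrum: `M` is isomorphic to the admissible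
clopen upsets of its spectrum `X`, and these are the complements of the compact open subsets of
`X₀`. Thus the open sets of `X₀` form a frame that represents `M`, with no need for a frame of
ideals. -/

theorem isCompactElement_sup [CompleteLattice L] {a b : L} (ha : IsCompactElement a)
    (hb : IsCompactElement b) : IsCompactElement (a ⊔ b) := by
  rw [isCompactElement_iff_le_of_directed_sSup_le] at *
  intro S hS hd h
  obtain ⟨x, hx, hax⟩ := ha S hS hd (le_sup_left.trans h)
  obtain ⟨y, hy, hby⟩ := hb S hS hd (le_sup_right.trans h)
  obtain ⟨z, hz, hxz, hyz⟩ := hd x hx y hy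
  exact ⟨z, hz, sup_le (hax.trans hxz) (hby.trans hyz)⟩

theorem isCompactElement_bot [CompleteLattice L] : IsCompactElement (⊥ : L) :=
  fun _ _ hne _ _ _ => ⟨hne.some, hne.some_mem, bot_le⟩

/-- The join-semilattice of compact elements. -/
abbrev CompactElement (L : Type u) [CompleteLattice L] := {k : L // IsCompactElement k}

instance [CompleteLattice L] : SemilatticeSup (CompactElement L) :=
  Subtype.semilatticeSup fun _ _ => isCompactElement_sup

instance [CompleteLattice L] : OrderBot (CompactElement L) where
  bot := ⟨⊥, isCompactElement_bot⟩
  bot_le _ := bot_le (α := L)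

theorem map_eq_sSup_compact [CompleteLattice L] [IsCompactlyGenerated L] [CompleteLattice N]
    (f : sSupHom L N) (a : L) : f a = sSup (f '' {k | IsCompactElement k ∧ k ≤ a}) := by
  rw [← map_sSup, sSup_compact_le_eq]

/-- Approximation of a value of a join-preserving map by values at compact elements. -/
theorem exists_compact_le_map [CompleteLattice L] [IsCompactlyGenerated L] [CompleteLattice N]
    (f : sSupHom L N) {x : N} (hx : IsCompactElement x) {a : L} (h : x ≤ f a) :
    ∃ k, IsCompactElement k ∧ k ≤ a ∧ x ≤ f k := by
  rw [map_eq_sSup_compact f a] at h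
  rw [isCompactElement_iff_le_of_directed_sSup_le] at hx
  obtain ⟨_, ⟨k, hk, rfl⟩, hxk⟩ := hx (f '' {k | IsCompactElement k ∧ k ≤ a})
    ⟨f ⊥, ⊥, ⟨isCompactElement_bot, bot_le⟩, rfl⟩ (by
    rintro _ ⟨k, hk, rfl⟩ _ ⟨l, hl, rfl⟩
    exact ⟨f (k ⊔ l), ⟨_, ⟨isCompactElement_sup hk.1 hl.1, sup_le hk.2 hl.2⟩, rfl⟩,
      OrderHomClass.mono f le_sup_left, OrderHomClass.mono f le_sup_right⟩) h
  exact ⟨k, hk.1, hk.2, hxk⟩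

/-- An ideal of compact elements that contains all compact elements below members of `S` contains
all compact elements below `sSup S`. -/
theorem compact_induction [CompleteLattice L] [IsCompactlyGenerated L]
    {p : CompactElement L → Prop} (hbot : p ⊥) (hsup : ∀ a b, p a → p b → p (a ⊔ b))
    (hle : ∀ a b, a ≤ b → p b → p a) {S : Set L}
    (hS : ∀ s ∈ S, ∀ k : CompactElement L, (k : L) ≤ s → p k) (k : CompactElement L)
    (hk : (k : L) ≤ sSup S) : p k := by
  -- Each member of `S` is the join of the compact elements below it, all of which satisfy `p`.
  have hT : (k : L) ≤ sSup {j : L | ∃ h : IsCompactElement j, p ⟨j, h⟩} := by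
    refine hk.trans (sSup_le fun s hs => ?_)
    rw [← sSup_compact_le_eq s]
    exact sSup_le_sSup fun j hj => ⟨hj.1, hS s hs ⟨j, hj.1⟩ hj.2⟩
  obtain ⟨t, ht, hkt⟩ := (isCompactElement_iff_exists_le_sSup_of_le_sSup L _).1 k.2 _ hT
  have : ∃ h : IsCompactElement (t.sup id), p ⟨t.sup id, h⟩ :=
    Finset.sup_induction (p := fun x : L => ∃ h : IsCompactElement x, p ⟨x, h⟩)
      ⟨isCompactElement_bot, hbot⟩
      (fun a ⟨ha, pa⟩ b ⟨hb, pb⟩ => ⟨isCompactElement_sup ha hb, hsup _ _ pa pb⟩)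
      fun b hb => ht hb
  obtain ⟨h, hp⟩ := this
  exact hle k _ hkt hp

/-- The restriction of a map preserving joins and compact elements to compact elements. -/
def restrictCompact [CompleteLattice L] [CompleteLattice N] (f : sSupHom L N)
    (hf : ∀ k, IsCompactElement k → IsCompactElement (f k)) :
    SupBotHom (CompactElement L) (CompactElement N) where
  toFun k := ⟨f k, hf k k.2⟩
  map_sup' a b := Subtype.ext (map_sup f a.1 b.1)
  map_bot' := Subtype.ext (map_bot f)

theorem extendCompact_aux [CompleteLattice L] [CompleteLattice N]
    (g : SupBotHom (CompactElement L) (CompactElement N)) {k : CompactElement L} {a : L}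
    (h : (k : L) ≤ a) : (g k : N) ≤ ⨆ (k : CompactElement L) (_ : (k : L) ≤ a), (g k : N) :=
  le_iSup₂ (f := fun (k : CompactElement L) (_ : (k : L) ≤ a) => (g k : N)) k h

/-- The join-preserving extension of a map defined on compact elements. -/
def extendCompact [CompleteLattice L] [IsCompactlyGenerated L] [CompleteLattice N]
    (g : SupBotHom (CompactElement L) (CompactElement N)) : sSupHom L N where
  toFun a := ⨆ (k : CompactElement L) (_ : (k : L) ≤ a), (g k : N)
  map_sSup' S := by
    apply le_antisymm
    · refine iSup₂_le fun k hk => ?_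
      -- The compact elements whose value under `g` lies below the right-hand side form an ideal.
      refine compact_induction (p := fun k => (g k : N) ≤ _) ?_ ?_ ?_ (S := S) ?_ k hk
      · rw [map_bot]
        exact bot_le (α := N)
      · intro a b ha hb
        rw [map_sup]
        exact sup_le (α := N) ha hb
      · exact fun a b hab hb => le_trans (α := N) (OrderHomClass.mono g hab) hb
      · exact fun s hs k hk => (extendCompact_aux g hk).trans (le_sSup ⟨s, hs, rfl⟩)
    · refine sSup_le ?_
      rintro _ ⟨s, hs, rfl⟩
      exact iSup₂_le fun k hk => extendCompact_aux g (hk.trans (le_sSup hs))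

theorem extendCompact_coe [CompleteLattice L] [IsCompactlyGenerated L] [CompleteLattice N]
    (g : SupBotHom (CompactElement L) (CompactElement N)) (k : CompactElement L) :
    extendCompact g (k : L) = g k :=
  le_antisymm (iSup₂_le fun _ h => OrderHomClass.mono g h) (extendCompact_aux g le_rfl)

/-- Let `d` be a complement of `c`. A cover of `k ⊓ c` together with `d` covers `k`, so `k ≤ s ⊔ d`
for one member `s` of the directed cover; meeting with `c` removes `d`. -/
theorem isCompactElement_inf_of_isComplemented [Order.Frame L] {k c : L}
    (hk : IsCompactElement k) (hc : IsComplemented c) : IsCompactElement (k ⊓ c) := by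
  obtain ⟨d, hd⟩ := hc
  rw [isCompactElement_iff_le_of_directed_sSup_le] at *
  intro S hS hdir h
  have hk' : k ≤ sSup ((· ⊔ d) '' S) := by
    have h1 : k ≤ sSup S ⊔ d := by
      calc k = k ⊓ (c ⊔ d) := by rw [hd.sup_eq_top, inf_top_eq]
        _ = k ⊓ c ⊔ k ⊓ d := inf_sup_left _ _ _
        _ ≤ _ := sup_le_sup h inf_le_right
    refine h1.trans (sup_le (sSup_le fun s hs => ?_) ?_)
    · exact le_sup_left.trans (le_sSup ⟨s, hs, rfl⟩)
    · exact le_sup_right.trans (le_sSup ⟨_, hS.some_mem, rfl⟩)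
  obtain ⟨_, ⟨s, hs, rfl⟩, hks⟩ := hk _ (hS.image _) (by
    rintro _ ⟨x, hx, rfl⟩ _ ⟨y, hy, rfl⟩
    obtain ⟨z, hz, hxz, hyz⟩ := hdir x hx y hy
    exact ⟨_, ⟨z, hz, rfl⟩, sup_le_sup_right hxz d, sup_le_sup_right hyz d⟩) hk'
  refine ⟨s, hs, ?_⟩
  calc k ⊓ c ≤ (s ⊔ d) ⊓ c := inf_le_inf_right c hks
    _ = s ⊓ c := by rw [inf_sup_right, hd.symm.inf_eq_bot, sup_bot_eq]
    _ ≤ s := inf_le_left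

/-- Compactness reduces a join of complemented elements to a finite one, and complemented elements
are closed under finite joins. -/
theorem IsZeroDimensional.isComplemented {L : AlgFrmJ.{u}} (hL : IsZeroDimensional L)
    {k : L.carrier} (hk : IsCompactElement k) : IsComplemented k := by
  obtain ⟨S, hS, rfl⟩ := hL k
  obtain ⟨t, ht, hkt⟩ := (isCompactElement_iff_exists_le_sSup_of_le_sSup _ _).1 hk S le_rfl
  have h : sSup S = t.sup id :=
    le_antisymm hkt (Finset.sup_le fun s hs => le_sSup (ht hs))
  rw [h]
  exact Finset.sup_induction isComplemented_bot (fun _ ha _ hb => ha.sup hb)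
    fun b hb => hS b (ht hb)

theorem IsZeroDimensional.isCompactElement_inf {L : AlgFrmJ.{u}} (hL : IsZeroDimensional L)
    {a b : L.carrier} (ha : IsCompactElement a) (hb : IsCompactElement b) :
    IsCompactElement (a ⊓ b) :=
  isCompactElement_inf_of_isComplemented ha (hL.isComplemented hb)

theorem IsZeroDimensional.isCompactElement_sInf {L : AlgFrmJ.{u}} (hL : IsZeroDimensional L)
    {S : Set L.carrier} (hS : S.Finite) (hne : S.Nonempty) (hc : ∀ k ∈ S, IsCompactElement k) :
    IsCompactElement (sInf S) := by
  obtain ⟨a, ha⟩ := hne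
  -- Keeping `a` as an extra factor lets the induction start at the empty set, whose meet `⊤` need
  -- not be compact.
  rw [← inf_eq_right.2 (sInf_le ha)]
  have ha' := hc a ha
  clear ha
  induction S, hS using Set.Finite.induction_on with
  | empty => simpa using ha'
  | @insert b S _ _ ih =>
    rw [sInf_insert, inf_left_comm]
    exact hL.isCompactElement_inf (hc b (Or.inl rfl)) (ih fun k hk => hc k (Or.inr hk))

end Compact

/-- The dual of the join-semilattice of compact elements. -/
def compactDual (L : AlgFrmJ.{u}) : SemilatInfCat.{u} := .of (CompactElement L.carrier)ᵒᵈ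

theorem isDistributive_compactDual {L : AlgFrmJ.{u}} (hL : IsZeroDimensional L) :
    IsDistributive (compactDual L) := by
  intro a b c h
  have h' : (ofDual c).1 ≤ (ofDual a).1 ⊔ (ofDual b).1 := h
  -- In the frame order, `c ≤ a ⊔ b` splits as `c = (c ⊓ a) ⊔ (c ⊓ b)`.
  refine ⟨toDual ⟨_, hL.isCompactElement_inf (ofDual c).2 (ofDual a).2⟩,
    toDual ⟨_, hL.isCompactElement_inf (ofDual c).2 (ofDual b).2⟩,
    inf_le_right (α := L.carrier), inf_le_right (α := L.carrier), ?_⟩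
  refine Subtype.ext (?_ : (ofDual c).1 ⊓ (ofDual a).1 ⊔ (ofDual c).1 ⊓ (ofDual b).1 = (ofDual c).1)
  rw [← inf_sup_left, inf_eq_left.2 h']

theorem isGenBoolean_compactDual {L : AlgFrmJ.{u}} (hL : IsZeroDimensional L) :
    IsGenBoolean ⟨compactDual L, isDistributive_compactDual hL⟩ := by
  constructor
  · intro a b
    refine ⟨toDual ⟨_, hL.isCompactElement_inf (ofDual a).2 (ofDual b).2⟩, ?_, ?_⟩
    · rintro _ (rfl | rfl)
      exacts [inf_le_left (α := L.carrier), inf_le_right (α := L.carrier)]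
    · intro c hc
      exact le_inf (α := L.carrier) (hc (Or.inl rfl)) (hc (Or.inr rfl))
  · intro a x hax
    have hax' : (ofDual x).1 ≤ (ofDual a).1 := hax
    obtain ⟨y, hy⟩ := hL.isComplemented (ofDual x).2
    -- The interval `[a, ⊤]` of the dual is the set of compact elements below `a`, where the
    -- complement of `x` is `a ⊓ y`.
    refine ⟨toDual ⟨(ofDual a).1 ⊓ y, isCompactElement_inf_of_isComplemented (ofDual a).2
      ⟨_, hy.symm⟩⟩, inf_le_left (α := L.carrier), ?_, ?_⟩
    · refine Subtype.ext (?_ : (ofDual x).1 ⊔ (ofDual a).1 ⊓ y = (ofDual a).1)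
      rw [sup_inf_left, hy.sup_eq_top, inf_top_eq, sup_eq_right.2 hax']
    · refine ⟨fun _ _ => le_top (α := (compactDual L)), fun c hc => ?_⟩
      refine (?_ : (ofDual c).1 ≤ ⊥)
      have h1 : (ofDual c).1 ≤ (ofDual x).1 := hc (Or.inl rfl)
      have h2 : (ofDual c).1 ≤ (ofDual a).1 ⊓ y := hc (Or.inr rfl)
      exact hy.inf_eq_bot ▸ le_inf h1 (h2.trans inf_le_right)

/-! ### Morphisms of generalized Boolean algebras -/

theorem DMS.hom_ext {M N : DMS.{u}} {α β : M ⟶ N} (h : ∀ x, DMS.toFun α x = DMS.toFun β x) :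
    α = β :=
  ObjectProperty.hom_ext _ (InfTopHom.ext h)

/-- Morphisms of `DMS` from homomorphisms of meet-semilattices. -/
def DMS.homMk {M N : DMS.{u}} (f : InfTopHom M.obj N.obj) : M ⟶ N :=
  ObjectProperty.homMk f

theorem GBAM.hom_ext {M N : GBAM.{u}} {α β : M ⟶ N}
    (h : ∀ x, DMS.toFun α.hom x = DMS.toFun β.hom x) : α = β :=
  ObjectProperty.hom_ext _ (DMS.hom_ext h)

/-- Isomorphisms of `DMS` from order isomorphisms. -/
def DMS.isoMk {M N : DMS.{u}} (e : M.obj ≃o N.obj) : M ≅ N :=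
  ObjectProperty.isoMk _ (SemilatInfCat.Iso.mk e)

theorem DMS.inv_hom_toFun {M N : DMS.{u}} (e : M ≅ N) (x : M.obj) :
    DMS.toFun e.inv (DMS.toFun e.hom x) = x :=
  congrArg (fun α => DMS.toFun α x) e.hom_inv_id

theorem DMS.hom_inv_toFun {M N : DMS.{u}} (e : M ≅ N) (x : N.obj) :
    DMS.toFun e.hom (DMS.toFun e.inv x) = x :=
  congrArg (fun α => DMS.toFun α x) e.inv_hom_id

theorem isSupMorphism_iso {M N : DMS.{u}} (e : M ≅ N) : IsSupMorphism e.hom := by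
  intro S _ _ a ha
  refine ⟨?_, fun y hy => ?_⟩
  · rintro _ ⟨s, hs, rfl⟩
    exact DMS.toFun_mono _ (ha.1 hs)
  · rw [← DMS.hom_inv_toFun e y]
    refine DMS.toFun_mono _ (ha.2 fun s hs => ?_)
    rw [← DMS.inv_hom_toFun e s]
    exact DMS.toFun_mono _ (hy ⟨s, hs, rfl⟩)

theorem isPMorphism_iso {M N : DMS.{u}} (e : M ≅ N) : IsPMorphism e.hom := by
  intro S _ x hx
  refine ⟨DMS.toFun e.inv x, fun s hs => ?_, (DMS.hom_inv_toFun e x).le⟩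
  rw [← DMS.inv_hom_toFun e s]
  exact DMS.toFun_mono _ (hx ⟨s, hs, rfl⟩)

/-! ### The functor from generalized Stone frames to generalized Boolean algebras -/

/-- The dual of the join-semilattice of compact elements, as a functor. -/
def compactFunctor : GStoneFrmJ.{u} ⥤ GBAM.{u} where
  obj L := ⟨⟨compactDual L.obj, isDistributive_compactDual L.property⟩,
    isGenBoolean_compactDual L.property⟩
  map f := ObjectProperty.homMk (DMS.homMk
    (SupBotHom.dual (restrictCompact f.hom.toHom f.hom.map_compact)))

instance : compactFunctor.{u}.Faithful where
  map_injective {L N f g} h := by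
    refine ObjectProperty.hom_ext _ (AlgFrmJ.Hom.ext (sSupHom.ext fun a => ?_))
    rw [map_eq_sSup_compact f.hom.toHom, map_eq_sSup_compact g.hom.toHom]
    congr 1
    refine Set.image_congr fun k hk => ?_
    have h' : DMS.toFun (compactFunctor.map f).hom = DMS.toFun (compactFunctor.map g).hom := by
      rw [h]
    exact congrArg Subtype.val (congrFun h' (toDual (⟨k, hk.1⟩ : CompactElement L.obj.carrier)))

instance : compactFunctor.{u}.Full where
  map_surjective {L N} β := by
    let g : SupBotHom (CompactElement L.obj.carrier) (CompactElement N.obj.carrier) :=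
      SupBotHom.dual.symm (show InfTopHom _ _ from β.hom.hom)
    refine ⟨ObjectProperty.homMk ⟨extendCompact g, fun k hk => ?_⟩, ?_⟩
    · have := extendCompact_coe g ⟨k, hk⟩
      rw [this]
      exact (g ⟨k, hk⟩).2
    · exact GBAM.hom_ext fun x => Subtype.ext (extendCompact_coe g (ofDual x))

/-- In the reversed order, the join of a nonempty finite set of compact elements is their meet in
the frame, because that meet is compact. -/
theorem preservesCompactMeets_iff {L N : GStoneFrmJ.{u}} (f : L ⟶ N) :
    PreservesCompactMeets f.hom ↔ IsSupMorphism (compactFunctor.map f).hom := by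
  have hmono : Monotone f.hom.toHom := OrderHomClass.mono _
  constructor
  · intro h S hS hne a ha
    refine ⟨?_, fun y hy => ?_⟩
    · rintro _ ⟨s, hs, rfl⟩
      exact DMS.toFun_mono _ (ha.1 hs)
    · let T : Set L.obj.carrier := (fun s : (CompactElement L.obj.carrier)ᵒᵈ => (ofDual s).1) '' S
      have hTc : IsCompactElement (sInf T) :=
        L.property.isCompactElement_sInf (hS.image _) (hne.image _) (by
          rintro _ ⟨s, _, rfl⟩
          exact (ofDual s).2)
      have hT := h T (hS.image _) (hne.image _) (by
          rintro _ ⟨s, _, rfl⟩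
          exact (ofDual s).2) hTc
      have hTa : sInf T ≤ (ofDual (show (CompactElement L.obj.carrier)ᵒᵈ from a)).1 :=
        ha.2 (show toDual (⟨sInf T, hTc⟩ : CompactElement L.obj.carrier) ∈ upperBounds S from
          fun s hs => sInf_le (α := L.obj.carrier) ⟨s, hs, rfl⟩)
      refine le_trans (α := N.obj.carrier) (?_ : _ ≤ f.hom.toHom (sInf T)) (hmono hTa)
      rw [hT]
      refine le_sInf ?_
      rintro _ ⟨_, ⟨s, hs, rfl⟩, rfl⟩
      exact hy ⟨s, hs, rfl⟩
  · intro h T hT hne hc hTc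
    let S : Set (CompactElement L.obj.carrier)ᵒᵈ := {s | (ofDual s).1 ∈ T}
    have hS : S.Finite := hT.preimage (Subtype.val_injective.injOn)
    obtain ⟨t, ht⟩ := hne
    have hlub := h S hS ⟨toDual ⟨t, hc t ht⟩, ht⟩ (toDual ⟨sInf T, hTc⟩) ⟨fun s hs =>
      sInf_le (α := L.obj.carrier) hs, fun s hs =>
      le_sInf (α := L.obj.carrier) fun t ht => hs (show toDual ⟨t, hc t ht⟩ ∈ S from ht)⟩
    apply le_antisymm
    · refine le_sInf ?_
      rintro _ ⟨t, ht, rfl⟩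
      exact hmono (sInf_le ht)
    · have hc' : IsCompactElement (sInf (f.hom.toHom '' T)) :=
        N.property.isCompactElement_sInf (hT.image _) ⟨_, t, ht, rfl⟩ (by
          rintro _ ⟨s, hs, rfl⟩
          exact f.hom.map_compact _ (hc s hs))
      refine hlub.2 (show toDual (⟨_, hc'⟩ : CompactElement N.obj.carrier) ∈ upperBounds _ from ?_)
      rintro _ ⟨s, hs, rfl⟩
      exact sInf_le (α := N.obj.carrier) ⟨_, hs, rfl⟩

theorem le_map_sInf_of_finite {L N : AlgFrmJ.{u}} {f : L ⟶ N} (hf : PreservesFiniteMeets f)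
    {T : Set L.carrier} (hT : T.Finite) {x : N.carrier} (hx : ∀ t ∈ T, x ≤ f.toHom t) :
    x ≤ f.toHom (sInf T) := by
  induction T, hT using Set.Finite.induction_on with
  | empty =>
    rw [sInf_empty, hf.1]
    exact le_top
  | insert _ _ ih =>
    rw [sInf_insert, hf.2]
    exact le_inf (hx _ (Or.inl rfl)) (ih fun t ht => hx t (Or.inr ht))

/-- An upper bound of `S` in the dual is a compact element below `sInf S`. If `f` preserves finite
meets, a compact `x` below `f (sInf S)` is already below `f k` for such a `k`. Conversely,
equalities in the target are tested on compact elements: `S = ∅` gives the top, and two-element sets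
give binary meets. -/
theorem preservesFiniteMeets_iff {L N : GStoneFrmJ.{u}} (f : L ⟶ N) :
    PreservesFiniteMeets f.hom ↔ IsPMorphism (compactFunctor.map f).hom := by
  have hmono : Monotone f.hom.toHom := OrderHomClass.mono _
  constructor
  · intro h S hS x hx
    have key := le_map_sInf_of_finite h
      (hS.image fun s : (CompactElement L.obj.carrier)ᵒᵈ => (ofDual s).1)
      (x := (ofDual (show (CompactElement N.obj.carrier)ᵒᵈ from x)).1) (by
        rintro _ ⟨s, hs, rfl⟩
        exact hx ⟨s, hs, rfl⟩)
    obtain ⟨k, hk, hkS, hxk⟩ := exists_compact_le_map f.hom.toHom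
      (ofDual (show (CompactElement N.obj.carrier)ᵒᵈ from x)).2 key
    exact ⟨toDual ⟨k, hk⟩, fun s hs => hkS.trans (sInf_le ⟨s, hs, rfl⟩), hxk⟩
  · intro h
    constructor
    · refine top_le_iff.1 (le_iff_compact_le_imp.2 fun x hx _ => ?_)
      obtain ⟨c, -, hc⟩ := h ∅ Set.finite_empty
        (toDual (⟨x, hx⟩ : CompactElement N.obj.carrier)) (by
          rintro _ ⟨_, ⟨⟩, _⟩)
      exact le_trans (α := N.obj.carrier) hc (hmono le_top)
    · intro a b
      refine le_antisymm (hmono.map_inf_le a b) (le_iff_compact_le_imp.2 fun x hx hxab => ?_)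
      obtain ⟨k, hk, hka, hxk⟩ := exists_compact_le_map f.hom.toHom hx (hxab.trans inf_le_left)
      obtain ⟨l, hl, hlb, hxl⟩ := exists_compact_le_map f.hom.toHom hx (hxab.trans inf_le_right)
      obtain ⟨c, hc, hxc⟩ := h {toDual ⟨k, hk⟩, toDual ⟨l, hl⟩} ((Set.finite_singleton _).insert _)
        (toDual (⟨x, hx⟩ : CompactElement N.obj.carrier)) (by
          rintro _ ⟨_, rfl | rfl, rfl⟩
          exacts [hxk, hxl])
      refine le_trans (α := N.obj.carrier) hxc (hmono (le_inf ?_ ?_))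
      · exact le_trans (α := L.obj.carrier) (hc (Or.inl rfl)) hka
      · exact le_trans (α := L.obj.carrier) (hc (Or.inr rfl)) hlb

/-! ### Admissible clopen upsets of pointed Stone spaces -/

/-- If `m ∉ U`, then `m` is itself a maximal point of the complement, outside the distinguished set.
Conversely, a set containing `m` is automatically an upset, since every strict inequality ends at
`m`. -/
theorem admissible_compl_singleton_iff {X : Type u} [TopologicalSpace X] [PartialOrder X] {m : X}
    (hm : ∀ x, x ≤ m) (hd : ∀ x y : X, x ≤ y → y ≠ m → x = y) {U : Set X} :
    Admissible {m}ᶜ U ↔ IsClopen U ∧ m ∈ U := by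
  constructor
  · rintro ⟨hU, -, h⟩
    refine ⟨hU, ?_⟩
    by_contra hmU
    exact h m ⟨hmU, fun y _ _ => hm y⟩ rfl
  · rintro ⟨hU, hmU⟩
    refine ⟨hU, fun x y hxy hx => ?_, ?_⟩
    · by_cases hy : y = m
      · rwa [hy]
      · rwa [← hd x y hxy hy]
    · rintro x hx rfl
      exact hx.1 hmU

/-- The pointed Stone space given by a compact ordered space with a top `m` in which the points
other than `m` are pairwise incomparable. -/
def PGPSpace.ofPointed (X : Type u) [TopologicalSpace X] [PartialOrder X] [CompactSpace X]
    [PriestleySpace X] (m : X) (hm : ∀ x, x ≤ m) (hd : ∀ x y : X, x ≤ y → y ≠ m → x = y) :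
    PGPSpace.{u} where
  carrier := X
  X₀ := {m}ᶜ
  m := m
  le_m := hm
  m_notMem h := h rfl
  dense x hx := subset_closure hx
  order_dense x hx := ⟨x, hx, le_rfl⟩
  mem_X₀_iff x := by
    constructor
    · intro hx
      constructor
      · obtain ⟨U, hU, -, hmU, hxU⟩ :=
          exists_isClopen_upper_of_not_le (fun h : m ≤ x => hx ((hm x).antisymm h))
        exact ⟨U, (admissible_compl_singleton_iff hm hd).2 ⟨hU, hmU⟩, hxU⟩
      · rintro U ⟨hU, hxU⟩ V ⟨hV, hxV⟩
        rw [admissible_compl_singleton_iff hm hd] at hU hV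
        exact ⟨U ∪ V, ⟨(admissible_compl_singleton_iff hm hd).2 ⟨hU.1.union hV.1, Or.inl hU.2⟩,
          fun h => h.elim hxU hxV⟩, Set.subset_union_left, Set.subset_union_right⟩
    · rintro ⟨⟨U, hU, hxU⟩, -⟩ rfl
      exact hxU ((admissible_compl_singleton_iff hm hd).1 hU).2
  le_iff x y := by
    refine ⟨fun h U hU hx => hU.2.1 h hx, fun h => ?_⟩
    by_contra hxy
    obtain ⟨U, hU, hup, hx, hy⟩ := exists_isClopen_upper_of_not_le hxy
    -- The separating upset contains `x`, hence `m`, hence is admissible.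
    exact hy (h U ((admissible_compl_singleton_iff hm hd).2 ⟨hU, hup (hm x) hx⟩) hx)

theorem PGPSpace.isPointedStone_ofPointed (X : Type u) [TopologicalSpace X] [PartialOrder X]
    [CompactSpace X] [PriestleySpace X] (m : X) (hm : ∀ x, x ≤ m)
    (hd : ∀ x y : X, x ≤ y → y ≠ m → x = y) : IsPointedStone (PGPSpace.ofPointed X m hm hd) :=
  ⟨rfl, fun x _ y hy hxy => hd x y hxy hy⟩

section Stone

variable {X Y : PGPSpace.{u}}

theorem IsPointedStone.mem_adm_iff (hX : IsPointedStone X) {U : Set X.carrier} :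
    U ∈ X.adm ↔ IsClopen U ∧ X.m ∈ U := by
  have h0 : X.X₀ = {X.m}ᶜ := hX.1
  have hd : ∀ x y : X.carrier, x ≤ y → y ≠ X.m → x = y := by
    intro x y hxy hy
    refine hX.2 x ?_ y (h0 ▸ hy) hxy
    rw [h0]
    rintro rfl
    exact hy ((X.le_m y).antisymm hxy)
  unfold PGPSpace.adm
  rw [h0]
  exact admissible_compl_singleton_iff X.le_m hd

theorem IsPointedStone.union_mem (hX : IsPointedStone X) {U V : Set X.carrier} (hU : U ∈ X.adm)
    (hV : V ∈ X.adm) : U ∪ V ∈ X.adm := by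
  rw [hX.mem_adm_iff] at *
  exact ⟨hU.1.union hV.1, Or.inl hU.2⟩

theorem IsPointedStone.union_compl_mem (hX : IsPointedStone X) {U V : Set X.carrier}
    (hU : U ∈ X.adm) (hV : V ∈ X.adm) : U ∪ Vᶜ ∈ X.adm := by
  rw [hX.mem_adm_iff] at *
  exact ⟨hU.1.union hV.1.compl, Or.inl hU.2⟩

theorem IsPointedStone.exists_adm_notMem (hX : IsPointedStone X) {x : X.carrier} (hx : x ≠ X.m) :
    ∃ U ∈ X.adm, x ∉ U := by
  have h : x ∈ X.X₀ := by
    rw [show X.X₀ = {X.m}ᶜ from hX.1]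
    exact hx
  exact ((X.mem_X₀_iff x).1 h).1

/-- A maximal point outside `U ∩ V` is outside `U` or outside `V`, and is maximal there too. -/
theorem PGPSpace.inter_mem_adm {U V : Set X.carrier} (hU : U ∈ X.adm) (hV : V ∈ X.adm) :
    U ∩ V ∈ X.adm := by
  refine ⟨hU.1.inter hV.1, hU.2.1.inter hV.2.1, fun x hx => ?_⟩
  by_cases hxU : x ∈ U
  · exact hV.2.2 x ⟨fun h => hx.1 ⟨hxU, h⟩, fun y hy hxy => hx.2 (fun h => hy h.2) hxy⟩
  · exact hU.2.2 x ⟨hxU, fun y hy hxy => hx.2 (fun h => hy h.1) hxy⟩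

theorem PGPSpace.univ_mem_adm : Set.univ ∈ X.adm :=
  ⟨isClopen_univ, isUpperSet_univ, fun _ hx => absurd trivial hx.1⟩

instance (X : PGPSpace.{u}) : SemilatticeInf X.adm :=
  Subtype.semilatticeInf fun _ _ => PGPSpace.inter_mem_adm

instance (X : PGPSpace.{u}) : OrderTop X.adm where
  top := ⟨Set.univ, PGPSpace.univ_mem_adm⟩
  le_top U := Set.subset_univ U.1

/-- The meet-semilattice of admissible clopen upsets. -/
def admInf (X : PGPSpace.{u}) : SemilatInfCat.{u} := .of X.adm

theorem IsPointedStone.isDistributive (hX : IsPointedStone X) : IsDistributive (admInf X) := by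
  rintro ⟨U, hU⟩ ⟨V, hV⟩ ⟨W, hW⟩ h
  have hUV : U ∩ V ⊆ W := h
  refine ⟨⟨W ∪ U, hX.union_mem hW hU⟩, ⟨W ∪ V, hX.union_mem hW hV⟩,
    Set.subset_union_right (s := W), Set.subset_union_right (s := W), Subtype.ext ?_⟩
  change (W ∪ U) ∩ (W ∪ V) = W
  rw [← Set.union_inter_distrib_left, Set.union_eq_left.2 hUV]

/-- The distributive meet-semilattice of admissible clopen upsets of a pointed Stone space. -/
def admDMS (X : PGPSpace.{u}) (hX : IsPointedStone X) : DMS.{u} := ⟨admInf X, hX.isDistributive⟩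

theorem IsPointedStone.isGenBoolean (hX : IsPointedStone X) : IsGenBoolean (admDMS X hX) := by
  constructor
  · rintro ⟨U, hU⟩ ⟨V, hV⟩
    refine ⟨(⟨U ∪ V, hX.union_mem hU hV⟩ : X.adm), ?_, ?_⟩
    · rintro _ (rfl | rfl)
      exacts [Set.subset_union_left (t := V), Set.subset_union_right (s := U)]
    · intro W hW
      exact Set.union_subset (s := U) (t := V) (hW (Or.inl rfl)) (hW (Or.inr rfl))
  · rintro ⟨A, hA⟩ ⟨U, hU⟩ h
    have h' : A ⊆ U := h
    -- The complement of `U` relative to `A`; it contains `m` because `A` does.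
    refine ⟨(⟨A ∪ Uᶜ, hX.union_compl_mem hA hU⟩ : X.adm), Set.subset_union_left (t := Uᶜ),
      Subtype.ext ?_, fun _ _ => le_top (α := X.adm), fun W hW x _ => ?_⟩
    · change U ∩ (A ∪ Uᶜ) = A
      rw [Set.inter_union_distrib_left, Set.inter_compl_self, Set.union_empty,
        Set.inter_eq_right.2 h']
    · by_cases hx : x ∈ U
      · exact (hW (Or.inl rfl) : U ⊆ W.1) hx
      · exact (hW (Or.inr rfl) : A ∪ Uᶜ ⊆ W.1) (Or.inr hx)

/-- Joins of nonempty finite sets of admissible clopen upsets are unions. -/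
theorem IsPointedStone.biUnion_mem (hX : IsPointedStone X) {S : Set X.adm} (hS : S.Finite)
    (hne : S.Nonempty) : ⋃ U ∈ S, U.1 ∈ X.adm := by
  rw [hX.mem_adm_iff]
  refine ⟨hS.isClopen_biUnion fun U _ => (hX.mem_adm_iff.1 U.2).1, ?_⟩
  obtain ⟨U, hU⟩ := hne
  exact Set.mem_biUnion hU (hX.mem_adm_iff.1 U.2).2

/-- Nonemptiness matters: an empty union misses `m`, so it is not admissible. -/
theorem IsPointedStone.eq_of_isLUB (hX : IsPointedStone X) {S : Set X.adm} (hS : S.Finite)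
    (hne : S.Nonempty) {A : X.adm} (hA : IsLUB S A) : A.1 = ⋃ U ∈ S, U.1 := by
  refine Set.Subset.antisymm ?_ (Set.iUnion₂_subset fun U hU => hA.1 hU)
  exact hA.2 (show (⟨_, hX.biUnion_mem hS hne⟩ : X.adm) ∈ upperBounds S from
    fun U hU => Set.subset_biUnion_of_mem (u := fun U : X.adm => U.1) hU)

/-! ### Realization of homomorphisms by relations and maps -/

/-- In a compact space, a filter base of closed sets and an ideal base of open sets such that no
member of the former is contained in a member of the latter are separated by a point. -/
theorem exists_mem_notMem_of_compact {Z : Type u} [TopologicalSpace Z] [CompactSpace Z]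
    {F G : Set (Set Z)} (hF : ∀ V ∈ F, IsClosed V) (hG : ∀ U ∈ G, IsOpen U) (hFne : F.Nonempty)
    (hGne : G.Nonempty) (hinf : ∀ V ∈ F, ∀ W ∈ F, V ∩ W ∈ F)
    (hsup : ∀ V ∈ G, ∀ W ∈ G, V ∪ W ∈ G) (h : ∀ V ∈ F, ∀ U ∈ G, ¬ V ⊆ U) :
    ∃ y, (∀ V ∈ F, y ∈ V) ∧ ∀ U ∈ G, y ∉ U := by
  have := hFne.to_subtype
  have := hGne.to_subtype
  have hcl : ∀ i : F × G, IsClosed (i.1.1 \ i.2.1) := fun i =>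
    (hF _ i.1.2).sdiff (hG _ i.2.2)
  -- The differences `V \ U` form a downward directed family of nonempty closed sets.
  obtain ⟨y, hy⟩ := IsCompact.nonempty_iInter_of_directed_nonempty_isCompact_isClosed
    (fun i : F × G => i.1.1 \ i.2.1) (fun i j => ⟨(⟨_, hinf _ i.1.2 _ j.1.2⟩,
      ⟨_, hsup _ i.2.2 _ j.2.2⟩), fun y hy => ⟨hy.1.1, fun h => hy.2 (Or.inl h)⟩,
      fun y hy => ⟨hy.1.2, fun h => hy.2 (Or.inr h)⟩⟩)
    (fun i => Set.sdiff_nonempty.2 (h _ i.1.2 _ i.2.2)) (fun i => (hcl i).isCompact) hcl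
  rw [Set.mem_iInter] at hy
  obtain ⟨V, hV⟩ := hFne
  obtain ⟨U, hU⟩ := hGne
  exact ⟨y, fun V hV => (hy (⟨V, hV⟩, ⟨U, hU⟩)).1, fun U hU => (hy (⟨V, hV⟩, ⟨U, hU⟩)).2⟩

/-- The homomorphism `□_R` of meet-semilattices given by a generalized Priestley morphism. -/
def boxHom (R : GPMor X Y) : InfTopHom Y.adm X.adm where
  toFun U := ⟨box R.rel U, R.box_mem U U.2⟩
  map_inf' _ _ := Subtype.ext (Set.ext fun _ =>
    ⟨fun h => ⟨fun y hy => (h y hy).1, fun y hy => (h y hy).2⟩, fun h y hy => ⟨h.1 y hy, h.2 y hy⟩⟩)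
  map_top' := Subtype.ext (Set.eq_univ_of_forall fun _ _ _ => trivial)

theorem boxHom_surjective (α : InfTopHom Y.adm X.adm) :
    ∃ R : GPMor X Y, boxHom R = α := by
  -- The largest relation with `α U ⊆ □_r U` for all `U`; compactness supplies the reverse
  -- inclusion.
  let r : X.carrier → Y.carrier → Prop := fun x y => ∀ U : Y.adm, x ∈ (α U).1 → y ∈ U.1
  have key : ∀ U : Y.adm, box r U = (α U).1 := by
    intro U
    ext x
    refine ⟨fun h => ?_, fun hx y hy => hy U hx⟩
    by_contra hx
    obtain ⟨y, hy, hyU⟩ := exists_mem_notMem_of_compact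
      (F := {V | ∃ W : Y.adm, x ∈ (α W).1 ∧ W.1 = V}) (G := {U.1})
      (by
        rintro _ ⟨W, -, rfl⟩
        exact W.2.1.isClosed)
      (by
        rintro _ rfl
        exact U.2.1.isOpen)
      ⟨_, ⊤, by rw [map_top]; trivial, rfl⟩ ⟨_, rfl⟩
      (by
        rintro _ ⟨V, hV, rfl⟩ _ ⟨W, hW, rfl⟩
        exact ⟨V ⊓ W, by rw [map_inf]; exact ⟨hV, hW⟩, rfl⟩)
      (by
        rintro _ rfl _ rfl
        exact Set.union_self _)
      (by
        rintro _ ⟨V, hV, rfl⟩ _ rfl hVU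
        exact hx ((OrderHomClass.mono α (show V ≤ U from hVU)) hV))
    exact hyU U rfl (h y fun W hW => hy W ⟨W, hW, rfl⟩)
  refine ⟨⟨r, fun _ _ h => ?_, fun U hU => ?_⟩, InfTopHom.ext fun U => Subtype.ext (key U)⟩
  · simp only [r, not_forall] at h
    obtain ⟨U, hU, hy⟩ := h
    exact ⟨U, U.2, fun z hz => hz U hU, hy⟩
  · rw [key ⟨U, hU⟩]
    exact (α ⟨U, hU⟩).2

/-- The homomorphism of meet-semilattices given by preimages under a strong Priestley morphism. -/
def preimageHom (f : StrongMor X Y) : InfTopHom Y.adm X.adm where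
  toFun U := ⟨f.toHom ⁻¹' U, f.preimage_mem U U.2⟩
  map_inf' _ _ := rfl
  map_top' := rfl

/-- Admissible clopen upsets determine the order, so equal preimages give `f x ≤ g x` and `g x ≤ f
x`. -/
theorem preimageHom_injective : Function.Injective (preimageHom (X := X) (Y := Y)) := by
  have key : ∀ f g : StrongMor X Y, preimageHom f = preimageHom g → ∀ x, f.toHom x ≤ g.toHom x := by
    intro f g h x
    rw [Y.le_iff]
    intro U hU hx
    have h' := congrArg (fun α : InfTopHom Y.adm X.adm => (α ⟨U, hU⟩).1) h
    exact (h' : f.toHom ⁻¹' U = g.toHom ⁻¹' U).subset hx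
  intro f g h
  exact StrongMor.ext (OrderHom.ext _ _ (funext fun x =>
    (key f g h x).antisymm (key g f h.symm x)))

/-- The image of `x` must be a point lying in `U` exactly when `x ∈ α U`. The `U` with `x ∈ α U` are
closed under intersection, and `hα` makes the remaining ones closed under union, so compactness
yields such a point. -/
theorem preimageHom_surjective (hY : IsPointedStone Y)
    (α : InfTopHom Y.adm X.adm)
    (hα : ∀ U V W : Y.adm, W.1 = U.1 ∪ V.1 → (α W).1 ⊆ (α U).1 ∪ (α V).1) :
    ∃ f : StrongMor X Y, preimageHom f = α := by
  have key : ∀ x : X.carrier, ∃ y : Y.carrier, ∀ U : Y.adm, y ∈ U.1 ↔ x ∈ (α U).1 := by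
    intro x
    -- If no `U` has to be avoided, the required point is `m`; otherwise the family to be avoided is
    -- nonempty.
    by_cases hx : ∀ U, x ∈ (α U).1
    · exact ⟨Y.m, fun U => iff_of_true (hY.mem_adm_iff.1 U.2).2 (hx U)⟩
    · rw [not_forall] at hx
      obtain ⟨U₀, hU₀⟩ := hx
      obtain ⟨y, hy, hyU⟩ := exists_mem_notMem_of_compact
        (F := {V | ∃ W : Y.adm, x ∈ (α W).1 ∧ W.1 = V})
        (G := {V | ∃ W : Y.adm, x ∉ (α W).1 ∧ W.1 = V})
        (by
          rintro _ ⟨W, -, rfl⟩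
          exact W.2.1.isClosed)
        (by
          rintro _ ⟨W, -, rfl⟩
          exact W.2.1.isOpen)
        ⟨_, ⊤, by rw [map_top]; trivial, rfl⟩ ⟨_, U₀, hU₀, rfl⟩
        (by
          rintro _ ⟨V, hV, rfl⟩ _ ⟨W, hW, rfl⟩
          exact ⟨V ⊓ W, by rw [map_inf]; exact ⟨hV, hW⟩, rfl⟩)
        (by
          rintro _ ⟨V, hV, rfl⟩ _ ⟨W, hW, rfl⟩
          exact ⟨⟨_, hY.union_mem V.2 W.2⟩, fun h => (hα V W _ rfl h).elim hV hW, rfl⟩)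
        (by
          rintro _ ⟨V, hV, rfl⟩ _ ⟨U, hU, rfl⟩ hVU
          exact hU ((OrderHomClass.mono α (show V ≤ U from hVU)) hV))
      refine ⟨y, fun U => ⟨fun h => ?_, fun h => hy _ ⟨U, h, rfl⟩⟩⟩
      by_contra hx
      exact hyU _ ⟨U, hx, rfl⟩ h
  choose f hf using key
  have hpre : ∀ U : Y.adm, f ⁻¹' U.1 = (α U).1 := fun U => Set.ext fun x => hf x U
  refine ⟨⟨⟨f, fun x x' hxx' => ?_⟩, fun U hU => ?_⟩,
    InfTopHom.ext fun U => Subtype.ext (hpre U)⟩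
  · rw [Y.le_iff]
    intro U hU hx
    exact (hf x' ⟨U, hU⟩).2 ((α ⟨U, hU⟩).2.2.1 hxx' ((hf x ⟨U, hU⟩).1 hx))
  · have h := (α ⟨U, hU⟩).2
    rw [← hpre] at h
    exact h

end Stone

/-! ### The spectrum of a generalized Boolean algebra -/

section Spectrum

/-- The lattice homomorphisms to the two-element lattice that preserve the top. The constant map is
the distinguished point; the other points are the prime filters. -/
def Spectrum (M : Type u) [DistribLattice M] [OrderTop M] : Type u :=
  {p : M → Bool // p ⊤ = true ∧ (∀ a b, p (a ⊓ b) = (p a && p b)) ∧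
    ∀ a b, p (a ⊔ b) = (p a || p b)}

variable {M : Type u} [DistribLattice M] [OrderTop M]

instance : TopologicalSpace (Spectrum M) := inferInstanceAs (TopologicalSpace (Subtype _))

instance : PartialOrder (Spectrum M) := inferInstanceAs (PartialOrder (Subtype _))

/-- The homomorphism equations cut out a closed subset of the compact product `M → Bool`. -/
instance : CompactSpace (Spectrum M) := by
  have h0 : IsClosed {p : M → Bool | p ⊤ = true} :=
    isClosed_eq (continuous_apply _) continuous_const
  have h1 : IsClosed {p : M → Bool | ∀ a b, p (a ⊓ b) = (p a && p b)} := by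
    simp only [Set.ofPred_forall]
    refine isClosed_iInter fun a => isClosed_iInter fun b => isClosed_eq (continuous_apply _) ?_
    have hab : Continuous fun p : M → Bool => (p a, p b) := by fun_prop
    exact (continuous_of_discreteTopology (f := fun q : Bool × Bool => q.1 && q.2)).comp hab
  have h2 : IsClosed {p : M → Bool | ∀ a b, p (a ⊔ b) = (p a || p b)} := by
    simp only [Set.ofPred_forall]
    refine isClosed_iInter fun a => isClosed_iInter fun b => isClosed_eq (continuous_apply _) ?_
    have hab : Continuous fun p : M → Bool => (p a, p b) := by fun_prop
    exact (continuous_of_discreteTopology (f := fun q : Bool × Bool => q.1 || q.2)).comp hab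
  exact isCompact_iff_compactSpace.1 (h0.inter (h1.inter h2)).isCompact

namespace Spectrum

/-- The basic clopen upset of an element. -/
def basic (a : M) : Set (Spectrum M) := {p | p.1 a = true}

theorem mem_basic_inf {p : Spectrum M} {a b : M} :
    p ∈ basic (a ⊓ b) ↔ p ∈ basic a ∧ p ∈ basic b := by
  simp [basic, p.2.2.1]

theorem mem_basic_sup {p : Spectrum M} {a b : M} :
    p ∈ basic (a ⊔ b) ↔ p ∈ basic a ∨ p ∈ basic b := by
  simp [basic, p.2.2.2]

theorem mem_basic_top (p : Spectrum M) : p ∈ basic (⊤ : M) := p.2.1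

theorem isClopen_basic (a : M) : IsClopen (basic a) :=
  (isClopen_discrete {true}).preimage ((continuous_apply a).comp continuous_subtype_val)

theorem basic_mono {a b : M} (h : a ≤ b) : basic a ⊆ basic b := by
  intro p hp
  rw [← sup_eq_right.2 h, mem_basic_sup]
  exact Or.inl hp

theorem le_iff_basic {p q : Spectrum M} : p ≤ q ↔ ∀ a, p ∈ basic a → q ∈ basic a :=
  Iff.rfl

instance : PriestleySpace (Spectrum M) where
  priestley {p q} h := by
    rw [le_iff_basic] at h
    push Not at h
    obtain ⟨a, hp, hq⟩ := h
    exact ⟨basic a, isClopen_basic a, fun p q hpq hp => le_iff_basic.1 hpq a hp, hp, hq⟩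

/-- The constant homomorphism. -/
def top (M : Type u) [DistribLattice M] [OrderTop M] : Spectrum M :=
  ⟨fun _ => true, rfl, fun _ _ => rfl, fun _ _ => rfl⟩

theorem le_top (p : Spectrum M) : p ≤ top M := fun _ _ => rfl

theorem exists_notMem_basic {p : Spectrum M} (hp : p ≠ top M) : ∃ a, p ∉ basic a := by
  by_contra! h
  exact hp (Subtype.ext (funext h))

theorem exists_mem_notMem_basic {a b : M} (h : ¬ a ≤ b) : ∃ p, p ∈ basic a ∧ p ∉ basic b := by
  classical
  -- The prime ideal theorem separates `a` from `b`; the required point is the indicator of the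
  -- complement of `J`.
  obtain ⟨J, hJ, hbJ, hd⟩ := DistribLattice.prime_ideal_of_disjoint_filter_ideal
    (F := Order.PFilter.principal a) (I := Order.Ideal.principal b)
    (Set.disjoint_left.2 fun c hac hcb => h (le_trans (Order.PFilter.mem_principal.1 hac) hcb))
  have haJ : a ∉ J := Set.disjoint_left.1 hd (Order.PFilter.mem_principal.2 le_rfl)
  have hbJ' : b ∈ J := hbJ (Order.Ideal.mem_principal.2 le_rfl)
  refine ⟨⟨fun c => decide (c ∉ J), ?_, fun c d => ?_, fun c d => ?_⟩, ?_, ?_⟩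
  · simpa using fun h => haJ (J.lower _root_.le_top h)
  · have : c ⊓ d ∈ J ↔ c ∈ J ∨ d ∈ J :=
      ⟨hJ.mem_or_mem, fun h => h.elim (J.lower inf_le_left) (J.lower inf_le_right)⟩
    simp [this]
  · simp [Order.Ideal.sup_mem_iff]
  · exact decide_eq_true haJ
  · exact fun h => of_decide_eq_true h hbJ'

theorem basic_subset_iff {a b : M} : basic a ⊆ basic b ↔ a ≤ b := by
  refine ⟨fun h => ?_, basic_mono⟩
  by_contra hab
  obtain ⟨p, hp, hq⟩ := exists_mem_notMem_basic hab
  exact hq (h hp)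

/-- Let `a ∈ q`, `b ∉ q`, and let `y` be the complement of `a` in `[a ⊓ b, ⊤]`. The prime filter `p`
contains `a` or `y`. If it contained `y`, then `q` would contain `a ⊓ y = a ⊓ b`, hence `b`. -/
theorem eq_of_le (hM : ∀ a x : M, a ≤ x → ∃ y, x ⊓ y = a ∧ x ⊔ y = ⊤) {p q : Spectrum M}
    (hpq : p ≤ q) (hq : q ≠ top M) : p = q := by
  refine hpq.antisymm (le_iff_basic.2 fun a ha => ?_)
  obtain ⟨b, hb⟩ := exists_notMem_basic hq
  obtain ⟨y, h1, h2⟩ := hM (a ⊓ b) a inf_le_left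
  have hp := mem_basic_top p
  rw [← h2, mem_basic_sup] at hp
  refine hp.resolve_right fun hy => hb ?_
  have := mem_basic_inf.2 ⟨ha, le_iff_basic.1 hpq y hy⟩
  rw [h1, mem_basic_inf] at this
  exact this.2

end Spectrum

end Spectrum

namespace Spectrum

variable {M : Type u} [DistribLattice M] [OrderTop M]

/-- The spectrum of a generalized Boolean algebra as a pointed Stone space. -/
def space (hM : ∀ a x : M, a ≤ x → ∃ y, x ⊓ y = a ∧ x ⊔ y = ⊤) : PGPSpace.{u} :=
  PGPSpace.ofPointed (Spectrum M) (top M) le_top fun _ _ => eq_of_le hM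

variable (hM : ∀ a x : M, a ≤ x → ∃ y, x ⊓ y = a ∧ x ⊔ y = ⊤)

theorem isPointedStone_space : IsPointedStone (space hM) :=
  PGPSpace.isPointedStone_ofPointed _ _ _ _

theorem mem_adm_space_iff {U : Set (Spectrum M)} :
    U ∈ (space hM).adm ↔ IsClopen U ∧ top M ∈ U :=
  (isPointedStone_space hM).mem_adm_iff

theorem basic_mem_adm (a : M) : basic a ∈ (space hM).adm :=
  (mem_adm_space_iff hM).2 ⟨isClopen_basic a, rfl⟩

/-- Every admissible clopen upset of the spectrum is basic. -/
theorem exists_basic_eq {U : Set (Spectrum M)} (hU : U ∈ (space hM).adm) :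
    ∃ a : M, basic a = U := by
  have hU' := (mem_adm_space_iff hM).1 hU
  -- Compactness of `U`: finitely many basic sets missing `q` cover `U`, and their union is basic.
  -- The empty cover needs some basic set missing `q`, which exists since `q` is not the top point.
  have h1 : ∀ q, q ∉ U → ∃ a : M, q ∉ basic a ∧ U ⊆ basic a := by
    intro q hq
    refine hU'.1.isClosed.isCompact.induction_on (p := fun s => ∃ a : M, q ∉ basic a ∧ s ⊆ basic a)
      ?_ ?_ ?_ ?_
    · obtain ⟨a, ha⟩ := exists_notMem_basic (p := q) (fun h => hq (h ▸ hU'.2))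
      exact ⟨a, ha, Set.empty_subset _⟩
    · rintro s t hst ⟨a, ha, hta⟩
      exact ⟨a, ha, hst.trans hta⟩
    · rintro s t ⟨a, ha, hsa⟩ ⟨b, hb, htb⟩
      exact ⟨a ⊔ b, fun h => (mem_basic_sup.1 h).elim ha hb,
        Set.union_subset (hsa.trans (basic_mono le_sup_left)) (htb.trans (basic_mono le_sup_right))⟩
    · intro p hp
      have hpq : ¬ p ≤ q := fun h => hq (hU.2.1 h hp)
      rw [le_iff_basic] at hpq
      push Not at hpq
      obtain ⟨a, hpa, hqa⟩ := hpq
      exact ⟨basic a, mem_nhdsWithin_of_mem_nhds ((isClopen_basic a).isOpen.mem_nhds hpa), a, hqa,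
        subset_rfl⟩
  -- Compactness of the complement: finitely many of these basic sets around `U` intersect in
  -- exactly `U`, and the intersection is basic.
  obtain ⟨a, hUa, haU⟩ := hU'.1.compl.isClosed.isCompact.induction_on
    (p := fun s => ∃ a : M, U ⊆ basic a ∧ Disjoint s (basic a))
    ⟨⊤, fun p _ => mem_basic_top p, Set.empty_disjoint _⟩
    (by
      rintro s t hst ⟨a, ha, hta⟩
      exact ⟨a, ha, hta.mono_left hst⟩)
    (by
      rintro s t ⟨a, ha, hsa⟩ ⟨b, hb, htb⟩
      exact ⟨a ⊓ b, fun p hp => mem_basic_inf.2 ⟨ha hp, hb hp⟩, Set.disjoint_union_left.2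
        ⟨hsa.mono_right (basic_mono inf_le_left), htb.mono_right (basic_mono inf_le_right)⟩⟩)
    (by
      intro q hq
      obtain ⟨a, hqa, hUa⟩ := h1 q hq
      exact ⟨(basic a)ᶜ, mem_nhdsWithin_of_mem_nhds
        ((isClopen_basic a).compl.isOpen.mem_nhds hqa), a, hUa, disjoint_compl_left⟩)
  exact ⟨a, (Set.disjoint_compl_left_iff_subset.1 haU).antisymm hUa⟩

/-- A generalized Boolean algebra is isomorphic to the lattice of admissible clopen upsets of its
spectrum. -/
noncomputable def orderIso : M ≃o (space hM).adm :=
  RelIso.ofSurjective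
    (OrderEmbedding.ofMapLEIff (fun a => (⟨basic a, basic_mem_adm hM a⟩ : (space hM).adm))
      fun _ _ => basic_subset_iff)
    fun U => (exists_basic_eq hM U.2).imp fun _ h => Subtype.ext h

end Spectrum

/-- A generalized Boolean algebra is a distributive lattice. -/
noncomputable abbrev IsGenBoolean.distribLattice {M : DMS.{u}} (hM : IsGenBoolean M) :
    DistribLattice M.obj where
  __ := (inferInstance : SemilatticeInf M.obj)
  sup a b := (hM.1 a b).choose
  le_sup_left a b := (hM.1 a b).choose_spec.1 (Or.inl rfl)
  le_sup_right a b := (hM.1 a b).choose_spec.1 (Or.inr rfl)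
  sup_le a b c ha hb := (hM.1 a b).choose_spec.2 (by
    rintro _ (rfl | rfl)
    exacts [ha, hb])
  le_sup_inf x y z := by
    have h := (hM.1 x (y ⊓ z)).choose_spec
    -- Semilattice distributivity splits `x ⊔ (y ⊓ z)` as `y' ⊓ z'`; then `y'` bounds `x, y` and
    -- `z'` bounds `x, z`.
    obtain ⟨y', z', hy, hz, hyz⟩ := M.property y z _ (h.1 (Or.inr rfl))
    have hx := h.1 (Or.inl rfl)
    rw [← hyz] at hx
    change (hM.1 x y).choose ⊓ (hM.1 x z).choose ≤ (hM.1 x (y ⊓ z)).choose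
    rw [← hyz]
    refine inf_le_inf ((hM.1 x y).choose_spec.2 ?_) ((hM.1 x z).choose_spec.2 ?_)
    · rintro _ (rfl | rfl)
      exacts [hx.trans inf_le_left, hy]
    · rintro _ (rfl | rfl)
      exacts [hx.trans inf_le_right, hz]

/-- Every generalized Boolean algebra is represented by a pointed Stone space. -/
theorem IsGenBoolean.exists_space {M : DMS.{u}} (hM : IsGenBoolean M) :
    ∃ X : PGPSpace.{u}, IsPointedStone X ∧ Nonempty (M.obj ≃o X.adm) := by
  let : DistribLattice M.obj := hM.distribLattice
  let : OrderTop M.obj := M.obj.isOrderTop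
  have h : ∀ a x : M.obj, a ≤ x → ∃ y, x ⊓ y = a ∧ x ⊔ y = ⊤ := by
    intro a x hax
    obtain ⟨y, -, h1, h2⟩ := hM.2 a x hax
    exact ⟨y, h1, isLUB_pair.unique h2⟩
  exact ⟨Spectrum.space h, Spectrum.isPointedStone_space h, ⟨Spectrum.orderIso h⟩⟩

/-! ### The frame of open sets of a pointed Stone space without its distinguished point -/

section OpenFrame

open TopologicalSpace

variable {X : PGPSpace.{u}}

theorem IsPointedStone.mem_X₀_iff (hX : IsPointedStone X) {x : X.carrier} :
    x ∈ X.X₀ ↔ x ≠ X.m := by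
  rw [show X.X₀ = {X.m}ᶜ from hX.1]
  rfl

theorem IsPointedStone.isOpen_X₀ (hX : IsPointedStone X) : IsOpen X.X₀ := by
  rw [show X.X₀ = {X.m}ᶜ from hX.1]
  exact isClosed_singleton.isOpen_compl

theorem IsPointedStone.image_compl (hX : IsPointedStone X) {U : Set X.carrier} (hU : X.m ∈ U) :
    (Subtype.val : X.X₀ → X.carrier) '' (Subtype.val ⁻¹' Uᶜ) = Uᶜ := by
  rw [Subtype.image_preimage_coe, Set.inter_eq_right]
  intro x hx
  exact hX.mem_X₀_iff.2 (fun h => hx (h ▸ hU))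

theorem IsPointedStone.isCompact_preimage (hX : IsPointedStone X) {U : Set X.carrier}
    (hU : U ∈ X.adm) : IsCompact ((Subtype.val : X.X₀ → X.carrier) ⁻¹' Uᶜ) := by
  rw [hX.mem_adm_iff] at hU
  rw [Subtype.isCompact_iff, hX.image_compl hU.2]
  exact hU.1.compl.isClosed.isCompact

/-- The compact open subset of `X₀` given by the complement of an admissible clopen upset. -/
def complOpens (U : X.adm) : Opens X.X₀ :=
  ⟨Subtype.val ⁻¹' U.1ᶜ, U.2.1.compl.isOpen.preimage continuous_subtype_val⟩

theorem IsPointedStone.isComplemented_complOpens (U : X.adm) : IsComplemented (complOpens U) := by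
  refine ⟨⟨Subtype.val ⁻¹' U.1, U.2.1.isOpen.preimage continuous_subtype_val⟩, ?_⟩
  refine IsCompl.of_eq (Opens.ext ?_) (Opens.ext ?_)
  · exact Set.compl_inter_self _
  · exact Set.compl_union_self _

theorem IsPointedStone.isCompactElement_complOpens (hX : IsPointedStone X) (U : X.adm) :
    IsCompactElement (complOpens U) :=
  (Opens.isCompactElement_iff _).2 (hX.isCompact_preimage U.2)

/-- Since `X₀` is open in `X`, clopen subsets of `X` inside `X₀` form a base of it, and their
complements contain `m`. This one fact makes the frame of open sets both algebraic and
zero-dimensional. -/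
theorem IsPointedStone.sSup_complOpens (hX : IsPointedStone X) (A : Opens X.X₀) :
    sSup {K | (∃ U : X.adm, complOpens U = K) ∧ K ≤ A} = A := by
  refine le_antisymm (sSup_le fun K hK => hK.2) fun x hx => ?_
  obtain ⟨V, hV, hxV, hVA⟩ := compact_exists_isClopen_in_isOpen
    (hX.isOpen_X₀.isOpenMap_subtype_val _ A.2) (Set.mem_image_of_mem Subtype.val hx)
  have hmV : X.m ∉ V := fun h => by
    obtain ⟨y, -, hy⟩ := hVA h
    exact X.m_notMem (hy ▸ y.2)
  refine Opens.mem_sSup.2 ⟨complOpens ⟨Vᶜ, hX.mem_adm_iff.2 ⟨hV.compl, hmV⟩⟩, ⟨⟨_, rfl⟩, ?_⟩, ?_⟩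
  · intro y hy
    obtain ⟨z, hz, hzy⟩ := hVA (not_not.1 hy)
    exact Subtype.ext hzy ▸ hz
  · exact not_not.2 hxV

/-- The algebraic frame of open subsets of `X₀`. -/
def openFrame (X : PGPSpace.{u}) (hX : IsPointedStone X) : AlgFrmJ.{u} where
  carrier := Opens X.X₀
  algebraic := ⟨fun A => ⟨_, by
    rintro _ ⟨⟨U, rfl⟩, -⟩
    exact hX.isCompactElement_complOpens U, hX.sSup_complOpens A⟩⟩

theorem isZeroDimensional_openFrame (hX : IsPointedStone X) :
    IsZeroDimensional (openFrame X hX) := fun A => ⟨_, by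
    rintro _ ⟨⟨U, rfl⟩, -⟩
    exact IsPointedStone.isComplemented_complOpens U, hX.sSup_complOpens A⟩

/-- A compact open subset of `X₀` is closed in the Hausdorff space `X` and open there, so its
complement is clopen and contains `m`. -/
theorem IsPointedStone.exists_complOpens_eq (hX : IsPointedStone X) {K : Opens X.X₀}
    (hK : IsCompactElement K) : ∃ U : X.adm, complOpens U = K := by
  have hK' : IsCompact (Subtype.val '' (K : Set X.X₀)) :=
    ((Opens.isCompactElement_iff _).1 hK).image continuous_subtype_val
  refine ⟨⟨(Subtype.val '' (K : Set X.X₀))ᶜ, hX.mem_adm_iff.2 ⟨IsClopen.compl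
    ⟨hK'.isClosed, hX.isOpen_X₀.isOpenMap_subtype_val _ K.2⟩, ?_⟩⟩, Opens.ext ?_⟩
  · rintro ⟨y, -, hy⟩
    exact X.m_notMem (hy ▸ y.2)
  · change Subtype.val ⁻¹' (Subtype.val '' (K : Set X.X₀))ᶜᶜ = _
    rw [compl_compl, Set.preimage_image_eq _ Subtype.val_injective]

theorem IsPointedStone.complOpens_le_iff (hX : IsPointedStone X) {U V : X.adm} :
    complOpens V ≤ complOpens U ↔ U ≤ V := by
  refine ⟨fun h x hx => ?_, fun h x hx hxU => hx (h hxU)⟩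
  by_contra hxV
  have hx₀ : x ∈ X.X₀ := hX.mem_X₀_iff.2 fun h => hxV (h ▸ (hX.mem_adm_iff.1 V.2).2)
  exact h (show (⟨x, hx₀⟩ : X.X₀) ∈ complOpens V from hxV) hx

/-- Admissible clopen upsets correspond to compact open subsets of `X₀`, with reversed order. -/
noncomputable def admOrderIso (hX : IsPointedStone X) :
    X.adm ≃o (CompactElement (Opens X.X₀))ᵒᵈ :=
  RelIso.ofSurjective
    (OrderEmbedding.ofMapLEIff (fun U => toDual (⟨complOpens U, hX.isCompactElement_complOpens U⟩ :
      CompactElement (Opens X.X₀))) fun _ _ => hX.complOpens_le_iff)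
    fun K => (hX.exists_complOpens_eq (ofDual K).2).imp fun _ h => Subtype.ext h

end OpenFrame

instance : compactFunctor.{u}.EssSurj where
  mem_essImage M := by
    obtain ⟨X, hX, ⟨e⟩⟩ := M.property.exists_space
    refine ⟨⟨openFrame X hX, isZeroDimensional_openFrame hX⟩,
      ⟨ObjectProperty.isoMk _ (DMS.isoMk ?_)⟩⟩
    exact (e.trans (admOrderIso hX)).symm

/-! ### Restriction of equivalences to wide subcategories -/

/-- The equivalence `h` makes the restricted functor well defined and full. Essential surjectivity
survives because `hiso` puts all isomorphisms of `D` into `W'`. -/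
theorem nonempty_equivalence_of_wide {C D : Type (u + 1)} [Category.{u} C] [Category.{u} D]
    (W : MorphismProperty C) (W' : MorphismProperty D) [W.IsMultiplicative] [W'.IsMultiplicative]
    {P : ObjectProperty C} {P' : ObjectProperty D} (F : P.FullSubcategory ⥤ P'.FullSubcategory)
    [F.Full] [F.Faithful] [F.EssSurj]
    (h : ∀ {X Y : P.FullSubcategory} (f : X ⟶ Y), W f.hom ↔ W' (F.map f).hom)
    (hiso : ∀ {X Y : D} (e : X ≅ Y), W' e.hom) :
    Nonempty (ObjectProperty.FullSubcategory (fun X : WideSubcategory W => P X.obj) ≌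
      ObjectProperty.FullSubcategory (fun X : WideSubcategory W' => P' X.obj)) := by
  let G : ObjectProperty.FullSubcategory (fun X : WideSubcategory W => P X.obj) ⥤
      ObjectProperty.FullSubcategory (fun X : WideSubcategory W' => P' X.obj) :=
    { obj := fun X => ⟨⟨(F.obj ⟨X.obj.obj, X.property⟩).obj⟩,
        (F.obj ⟨X.obj.obj, X.property⟩).property⟩
      map := fun {X Y} f => ObjectProperty.homMk ⟨(F.map
        (ObjectProperty.homMk f.hom.hom : (⟨X.obj.obj, X.property⟩ : P.FullSubcategory) ⟶
          ⟨Y.obj.obj, Y.property⟩)).hom, (h _).1 f.hom.property⟩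
      map_id := fun X => by
        have h1 := congrArg InducedCategory.Hom.hom (F.map_id ⟨X.obj.obj, X.property⟩)
        exact ObjectProperty.hom_ext _ (WideSubcategory.hom_ext _ h1)
      map_comp := fun {X Y Z} f g => by
        have h1 := congrArg InducedCategory.Hom.hom (F.map_comp
          (ObjectProperty.homMk f.hom.hom : (⟨X.obj.obj, X.property⟩ : P.FullSubcategory) ⟶
            ⟨Y.obj.obj, Y.property⟩)
          (ObjectProperty.homMk g.hom.hom : (⟨Y.obj.obj, Y.property⟩ : P.FullSubcategory) ⟶
            ⟨Z.obj.obj, Z.property⟩))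
        exact ObjectProperty.hom_ext _ (WideSubcategory.hom_ext _ h1) }
  have : G.Faithful := ⟨fun {X Y f g} hfg => by
    have h1 := congrArg (fun f => f.hom.hom) hfg
    have h2 := F.map_injective (ObjectProperty.hom_ext _ h1)
    exact ObjectProperty.hom_ext _ (WideSubcategory.hom_ext _
      (congrArg InducedCategory.Hom.hom h2))⟩
  have : G.Full := ⟨fun {X Y} g => by
    obtain ⟨f, hf⟩ := F.map_surjective (X := ⟨X.obj.obj, X.property⟩)
      (Y := ⟨Y.obj.obj, Y.property⟩) (ObjectProperty.homMk g.hom.hom)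
    refine ⟨ObjectProperty.homMk ⟨f.hom, (h f).2 ?_⟩, ?_⟩
    · rw [hf]
      exact g.hom.property
    · exact ObjectProperty.hom_ext _ (WideSubcategory.hom_ext _
        (congrArg InducedCategory.Hom.hom hf))⟩
  have : G.EssSurj := ⟨fun Z => by
    let e := P'.ι.mapIso (F.objObjPreimageIso ⟨Z.obj.obj, Z.property⟩)
    exact ⟨⟨⟨(F.objPreimage ⟨Z.obj.obj, Z.property⟩).obj⟩,
      (F.objPreimage ⟨Z.obj.obj, Z.property⟩).property⟩,
      ⟨ObjectProperty.isoMk _ (WideSubcategory.isoMk e (hiso e) (hiso e.symm))⟩⟩⟩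
  have : G.IsEquivalence := {}
  exact ⟨G.asEquivalence⟩

/-! ### The functors from pointed Stone spaces to generalized Boolean algebras -/

section Functors

open Opposite

/-- Admissible clopen upsets and boxes of generalized Priestley morphisms, as a functor. -/
def boxFunctor : PStone.{u}ᵒᵖ ⥤ GBAM.{u} where
  obj X := ⟨admDMS X.unop.obj.space X.unop.property, X.unop.property.isGenBoolean⟩
  map R := ObjectProperty.homMk (DMS.homMk (boxHom R.unop.hom))
  map_id _ := GBAM.hom_ext fun U => Subtype.ext (GPMor.box_id U.2)
  map_comp _ _ := GBAM.hom_ext fun U => Subtype.ext (GPMor.box_comp _ _ U.2)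

instance : boxFunctor.{u}.Faithful where
  map_injective {X Y R S} h := by
    refine Quiver.Hom.unop_inj (ObjectProperty.hom_ext _ (GPMor.ext_box fun U hU => ?_))
    have h' : DMS.toFun (boxFunctor.map R).hom = DMS.toFun (boxFunctor.map S).hom := by rw [h]
    exact congrArg Subtype.val (congrFun h' (⟨U, hU⟩ : X.unop.obj.space.adm))

instance : boxFunctor.{u}.Full where
  map_surjective {X Y} α := by
    obtain ⟨R, hR⟩ := boxHom_surjective (X := Y.unop.obj.space) (Y := X.unop.obj.space) α.hom.hom
    exact ⟨(ObjectProperty.homMk R : Y.unop ⟶ X.unop).op,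
      GBAM.hom_ext fun U => congrArg (fun β => β U) hR⟩

instance : boxFunctor.{u}.EssSurj where
  mem_essImage M := by
    obtain ⟨X, hX, ⟨e⟩⟩ := M.property.exists_space
    exact ⟨op ⟨⟨X⟩, hX⟩, ⟨ObjectProperty.isoMk _ (DMS.isoMk e.symm)⟩⟩

/-! ### Strong Priestley morphisms and lattice homomorphisms -/

variable {X Y : PGPSpace.{u}} {hX : IsPointedStone X} {hY : IsPointedStone Y}

theorem isSupMorphism_preimageHom (f : StrongMor X Y) :
    IsSupMorphism (DMS.homMk (preimageHom f) : admDMS Y hY ⟶ admDMS X hX) := by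
  intro S hS hne A hA
  have hA' := hY.eq_of_isLUB hS hne hA
  refine ⟨?_, fun W hW x hx => ?_⟩
  · rintro _ ⟨U, hU, rfl⟩
    exact DMS.toFun_mono _ (hA.1 hU)
  · have hx' : f.toHom x ∈ (show Y.adm from A).1 := hx
    rw [hA', Set.mem_iUnion₂] at hx'
    obtain ⟨U, hU, hxU⟩ := hx'
    exact hW ⟨U, hU, rfl⟩ hxU

theorem IsSupMorphism.exists_strongMor {α : admDMS Y hY ⟶ admDMS X hX} (hα : IsSupMorphism α) :
    ∃ f : StrongMor X Y, DMS.homMk (preimageHom f) = α := by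
  obtain ⟨f, hf⟩ := preimageHom_surjective (X := X) hY α.hom (by
    intro U V W hW
    have h := hα {U, V} ((Set.finite_singleton _).insert _) ⟨U, Or.inl rfl⟩ W ⟨by
      rintro _ (rfl | rfl)
      exacts [Set.subset_union_left.trans_eq hW.symm, Set.subset_union_right.trans_eq hW.symm],
      fun Z hZ => hW.subset.trans (Set.union_subset (hZ (Or.inl rfl)) (hZ (Or.inr rfl)))⟩
    refine h.2 (show (⟨_, hX.union_mem (DMS.toFun α U).2 (DMS.toFun α V).2⟩ : X.adm) ∈
      upperBounds _ from ?_)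
    rintro _ ⟨_, rfl | rfl, rfl⟩
    exacts [Set.subset_union_left, Set.subset_union_right])
  exact ⟨f, DMS.hom_ext fun U => congrArg (fun β => β U) hf⟩

/-- An upper bound `y` of `α[S]` dominates `α c` for some upper bound `c` of `S`, and the join of
`S` lies below `c`. -/
theorem IsPMorphism.isSupMorphism {M N : DMS.{u}} {α : M ⟶ N} (hα : IsPMorphism α) :
    IsSupMorphism α := by
  intro S hS _ a ha
  refine ⟨?_, fun y hy => ?_⟩
  · rintro _ ⟨s, hs, rfl⟩
    exact DMS.toFun_mono _ (ha.1 hs)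
  · obtain ⟨c, hc, hcy⟩ := hα S hS y hy
    exact (DMS.toFun_mono _ (ha.2 hc)).trans hcy

/-- For nonempty `S` the union is an upper bound whose preimage is the union of the preimages, so
the condition is automatic. Only `S = ∅` has content: every admissible `W` must contain the preimage
of some admissible `C`. -/
theorem isPMorphism_preimageHom_iff (f : StrongMor X Y) :
    IsPMorphism (DMS.homMk (preimageHom f) : admDMS Y hY ⟶ admDMS X hX) ↔
      ∀ x ∈ X.X₀, f.toHom x ∈ Y.X₀ := by
  constructor
  · intro h x hx
    obtain ⟨W, hW, hxW⟩ := hX.exists_adm_notMem (hX.mem_X₀_iff.1 hx)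
    obtain ⟨C, -, hC⟩ := h ∅ Set.finite_empty (⟨W, hW⟩ : X.adm) (by rintro _ ⟨_, ⟨⟩, _⟩)
    refine hY.mem_X₀_iff.2 fun hfx => hxW (hC (?_ : f.toHom x ∈ (show Y.adm from C).1))
    rw [hfx]
    exact (hY.mem_adm_iff.1 (show Y.adm from C).2).2
  · intro h S hS W hW
    rcases S.eq_empty_or_nonempty with rfl | hne
    · obtain ⟨C, hC⟩ : ∃ C : Y.adm, f.toHom ⁻¹' C.1 ⊆ (show X.adm from W).1 := by
        -- Each point outside `W` is in `X₀`, so its image is not `m` and some `C` misses it;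
        -- compactness of the complement of `W` leaves finitely many such `C` to intersect.
        obtain ⟨C, hC⟩ := (show X.adm from W).2.1.compl.isClosed.isCompact.induction_on
          (p := fun s => ∃ C : Y.adm, Disjoint s (f.toHom ⁻¹' C.1))
          ⟨⊤, Set.empty_disjoint _⟩
          (by
            rintro s t hst ⟨C, hC⟩
            exact ⟨C, hC.mono_left hst⟩)
          (by
            rintro s t ⟨C, hC⟩ ⟨D, hD⟩
            exact ⟨C ⊓ D, Set.disjoint_union_left.2 ⟨hC.mono_right (fun _ h => h.1),
              hD.mono_right (fun _ h => h.2)⟩⟩)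
          (by
            intro x hx
            have hx₀ : x ∈ X.X₀ := hX.mem_X₀_iff.2
              fun h => hx (h ▸ (hX.mem_adm_iff.1 (show X.adm from W).2).2)
            obtain ⟨C, hC, hxC⟩ := hY.exists_adm_notMem (hY.mem_X₀_iff.1 (h x hx₀))
            exact ⟨(f.toHom ⁻¹' C)ᶜ, mem_nhdsWithin_of_mem_nhds
              ((f.preimage_mem C hC).1.compl.isOpen.mem_nhds hxC), ⟨C, hC⟩, disjoint_compl_left⟩)
        exact ⟨C, Set.disjoint_compl_left_iff_subset.1 hC⟩
      exact ⟨C, by rintro _ ⟨⟩, hC⟩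
    · refine ⟨(⟨_, hY.biUnion_mem hS hne⟩ : Y.adm), fun U hU =>
        Set.subset_biUnion_of_mem (u := fun U : Y.adm => U.1) hU, fun x hx => ?_⟩
      obtain ⟨U, hU, hxU⟩ := Set.mem_iUnion₂.1 hx
      exact hW ⟨U, hU, rfl⟩ hxU

theorem homMk_preimageHom_injective {f g : StrongMor X Y}
    (h : (DMS.homMk (preimageHom f) : admDMS Y hY ⟶ admDMS X hX) = DMS.homMk (preimageHom g)) :
    f = g :=
  preimageHom_injective (congrArg (fun α => α.hom) h)

/-- Admissible clopen upsets and preimages under strong Priestley morphisms, as a functor. -/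
def preimageFunctor : PStoneS.{u}ᵒᵖ ⥤ GBA.{u} where
  obj X := ⟨⟨admDMS X.unop.obj.space X.unop.property⟩, X.unop.property.isGenBoolean⟩
  map {X Y} f := ObjectProperty.homMk ⟨DMS.homMk (preimageHom f.unop.hom), isSupMorphism_preimageHom
    (hX := Y.unop.property) (hY := X.unop.property) _⟩

instance : preimageFunctor.{u}.Faithful where
  map_injective {X Y f g} h := by
    have h' := congrArg (fun α => α.hom.hom) h
    exact Quiver.Hom.unop_inj (ObjectProperty.hom_ext _
      (homMk_preimageHom_injective (hX := Y.unop.property) (hY := X.unop.property) h'))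

instance : preimageFunctor.{u}.Full where
  map_surjective {X Y} α := by
    obtain ⟨f, hf⟩ := IsSupMorphism.exists_strongMor (hX := Y.unop.property)
      (hY := X.unop.property) (α := α.hom.hom) α.hom.property
    exact ⟨(ObjectProperty.homMk f : Y.unop ⟶ X.unop).op,
      ObjectProperty.hom_ext _ (WideSubcategory.hom_ext _ hf)⟩

instance : preimageFunctor.{u}.EssSurj where
  mem_essImage M := by
    obtain ⟨X, hX, ⟨e⟩⟩ := M.property.exists_space
    let i : admDMS X hX ≅ M.obj.obj := DMS.isoMk e.symm
    exact ⟨op ⟨⟨X⟩, hX⟩, ⟨ObjectProperty.isoMk _ (WideSubcategory.isoMk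
      (X := ⟨admDMS X hX⟩) (Y := M.obj) i (isSupMorphism_iso i)
      (isSupMorphism_iso i.symm))⟩⟩

/-- Admissible clopen upsets and preimages under strong Priestley morphisms that preserve the
distinguished subset, as a functor. -/
def preimageFunctorP : PStoneP.{u}ᵒᵖ ⥤ GBAP.{u} where
  obj X := ⟨⟨admDMS X.unop.obj.obj.space X.unop.property⟩, X.unop.property.isGenBoolean⟩
  map {X Y} f := ObjectProperty.homMk ⟨DMS.homMk (preimageHom f.unop.hom.hom),
    (isPMorphism_preimageHom_iff (hX := Y.unop.property) (hY := X.unop.property) _).2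
      f.unop.hom.property⟩

instance : preimageFunctorP.{u}.Faithful where
  map_injective {X Y f g} h := by
    have h' := congrArg (fun α => α.hom.hom) h
    exact Quiver.Hom.unop_inj (ObjectProperty.hom_ext _ (WideSubcategory.hom_ext _
      (homMk_preimageHom_injective (hX := Y.unop.property) (hY := X.unop.property) h')))

instance : preimageFunctorP.{u}.Full where
  map_surjective {X Y} α := by
    obtain ⟨f, hf⟩ := IsSupMorphism.exists_strongMor (hX := Y.unop.property)
      (hY := X.unop.property) (α := α.hom.hom) α.hom.property.isSupMorphism
    have hf₀ := α.hom.property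
    rw [← hf] at hf₀
    exact ⟨(ObjectProperty.homMk ⟨f, (isPMorphism_preimageHom_iff f).1 hf₀⟩ : Y.unop ⟶ X.unop).op,
      ObjectProperty.hom_ext _ (WideSubcategory.hom_ext _ hf)⟩

instance : preimageFunctorP.{u}.EssSurj where
  mem_essImage M := by
    obtain ⟨X, hX, ⟨e⟩⟩ := M.property.exists_space
    let i : admDMS X hX ≅ M.obj.obj := DMS.isoMk e.symm
    exact ⟨op ⟨⟨⟨X⟩⟩, hX⟩, ⟨ObjectProperty.isoMk _ (WideSubcategory.isoMk
      (X := ⟨admDMS X hX⟩) (Y := M.obj) i (isPMorphism_iso i)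
      (isPMorphism_iso i.symm))⟩⟩

end Functors

/-! ### Assembly of the equivalences and dualities -/

instance : compactFunctor.{u}.IsEquivalence where

instance : boxFunctor.{u}.IsEquivalence where

instance : preimageFunctor.{u}.IsEquivalence where

instance : preimageFunctorP.{u}.IsEquivalence where

end PointedStone

theorem mainTheorem12 :
    (Nonempty (GStoneFrmJ.{u} ≌ GBAM.{u}) ∧ Nonempty (GStoneFrmJ.{u} ≌ PStone.{u}ᵒᵖ)) ∧
    (Nonempty (GStoneFrmS.{u} ≌ GBA.{u}) ∧ Nonempty (GStoneFrmS.{u} ≌ PStoneS.{u}ᵒᵖ)) ∧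
    (Nonempty (GStoneFrm.{u} ≌ GBAP.{u}) ∧ Nonempty (GStoneFrm.{u} ≌ PStoneP.{u}ᵒᵖ)) := by
  obtain ⟨eS⟩ : Nonempty (GStoneFrmS.{u} ≌ GBA.{u}) :=
    nonempty_equivalence_of_wide PreservesCompactMeets IsSupMorphism compactFunctor
      preservesCompactMeets_iff isSupMorphism_iso
  obtain ⟨eP⟩ : Nonempty (GStoneFrm.{u} ≌ GBAP.{u}) :=
    nonempty_equivalence_of_wide PreservesFiniteMeets IsPMorphism compactFunctor
      preservesFiniteMeets_iff isPMorphism_iso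
  exact ⟨⟨⟨compactFunctor.asEquivalence⟩,
      ⟨compactFunctor.asEquivalence.trans boxFunctor.asEquivalence.symm⟩⟩,
    ⟨⟨eS⟩, ⟨eS.trans preimageFunctor.asEquivalence.symm⟩⟩,
    ⟨⟨eP⟩, ⟨eP.trans preimageFunctorP.asEquivalence.symm⟩⟩⟩
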